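/- Let $M$ be a smooth manifold (Hausdorff, second countable, without boundary; for instance closed) of dimension $m$, and let $\sigma$ be a smooth closed $2$-form on $M$. Let $\tau:E\to M$ be a smooth principal $S^1$-bundle, $Z_q=\frac{d}{dt}\big|_{t=0}e^{it}q$ its fundamental vector field, and $\theta$ a connection $1$-form on $E$, i.e. a smooth $S^1$-invariant $1$-form with $\theta(Z)=1$, whose curvature is $\sigma$: $d\theta=\tau^*\sigma$. For a manifold $N$ with cotangent projection $\pi:T^*N\to N$ let $\lambda_{(q,p)}=\langle p,d\pi\,\cdot\,\rangle$ be the Liouville form and $\omega=d\lambda$ the standard symplectic form on $T^*N$; on $T^*M$ these objects are written $\bar\pi,\bar\lambda,\bar\omega$. The circle acts on $T^*E$ by $e^{it}(q,p)=(e^{it}q,\,p\circ(d_qe^{it})^{-1})$, and $A:T^*E\to\mathbb R$ denotes the function $A(q,p)=\langle p,Z_q\rangle$ (classically, the momentum map of this action). Let $c\in\mathbb R$, let $\imath:A^{-1}(c)\hookrightarrow T^*E$ be the inclusion and $\mathrm{pr}:A^{-1}(c)\to T^*E/\!\!/_cS^1:=A^{-1}(c)/S^1$ the projection. Then: 1.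 The twisted form $\bar\omega+c\,\bar\pi^*\sigma$ is a symplectic form on $T^*M$, and there is a unique map $\Pi_c:A^{-1}(c)\to T^*M$ such that, for all $(q,p)\in A^{-1}(c)$, the value $\Pi_c(q,p)$ is a covector at $\tau(q)$ with $$\langle\Pi_c(q,p),d_q\tau\,v\rangle=\langle p,v\rangle-c\,\theta(v)\qquad\text{for all }v\in T_qE .$$ 2. The symplectic quotient is well defined: with the subspace and quotient topologies, $A^{-1}(c)$ and $T^*E/\!\!/_cS^1$ admit smooth structures of dimensions $2m+1$ and $2m$ for which $\imath$ is a smooth embedding and $\mathrm{pr}$ is a smooth submersion; and for any such structures there is exactly one $2$-form $\bar\omega_c$ on $T^*E/\!\!/_cS^1$ with $\mathrm{pr}^*\bar\omega_c=\imath^*\omega$, and it is symplectic. 3. For any such structures $\Pi_c$ induces a symplectomorphism $$(T^*E/\!\!/_cS^1,\ \bar\omega_c)\ \cong\ (T^*M,\ \bar\omega+c\,\bar\pi^*\sigma),$$ that is, there is a smooth diffeomorphism $\Phi:T^*E/\!\!/_cS^1\to T^*M$ with $\Phi\circ\mathrm{pr}=\Pi_c$ and $\Phi^*(\bar\omega+c\,\bar\pi^*\sigma)=\bar\omega_c$.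 -/

import Mathlib

open Set Topology Bundle
open scoped Manifold ContDiff

noncomputable section

namespace MagneticReduction

section Forms

variable {V : Type*} [NormedAddCommGroup V] [NormedSpace ℝ V] {H : Type*} [TopologicalSpace H]
  (I : ModelWithCorners ℝ V H) (N : Type*) [TopologicalSpace N] [ChartedSpace H N]
  {V' : Type*} [NormedAddCommGroup V'] [NormedSpace ℝ V'] {H' : Type*} [TopologicalSpace H']
  (I' : ModelWithCorners ℝ V' H') {N' : Type*} [TopologicalSpace N'] [ChartedSpace H' N']

/-- A (not necessarily smooth) differential `k`-form on the manifold `N`. -/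
abbrev DForm (k : ℕ) : Type _ := ∀ x : N, TangentSpace I x [⋀^Fin k]→L[ℝ] ℝ

/-- A (not necessarily smooth) field of covectors on the manifold `N`. -/
abbrev CovectorField : Type _ := ∀ x : N, TangentSpace I x →L[ℝ] ℝ

variable {I N}

/-- A field of covectors, regarded as a differential `1`-form. -/
def oneForm (α : CovectorField I N) : DForm I N 1 :=
  fun x => ContinuousAlternatingMap.ofSubsingleton ℝ (TangentSpace I x) ℝ (0 : Fin 1) (α x)

/-- The pullback `f^* η`. -/
def pullback {k : ℕ} (f : N → N') (η : DForm I' N' k) : DForm I N k :=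
  fun x => (η (f x)).compContinuousLinearMap (mfderiv I I' f x)

/-- The local expression of `η` in the preferred chart `φ` at `x₀`: the pullback of `η` under
`φ⁻¹`, a form on (the target of `φ` in) the model vector space. -/
def localExpr {k : ℕ} (η : DForm I N k) (x₀ : N) : V → V [⋀^Fin k]→L[ℝ] ℝ :=
  fun y => (η ((extChartAt I x₀).symm y)).compContinuousLinearMap
    (mfderivWithin 𝓘(ℝ, V) I (extChartAt I x₀).symm (range I) y)

/-- Smoothness of a differential form: all its local expressions are smooth. -/
def IsSmoothForm {k : ℕ} (η : DForm I N k) : Prop :=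
  ∀ x₀ : N, ContDiffOn ℝ ∞ (localExpr η x₀) (extChartAt I x₀).target

/-- The exterior derivative, computed at `x` in the preferred chart at `x`. -/
def extD {k : ℕ} (η : DForm I N k) : DForm I N (k + 1) :=
  fun x => ContinuousAlternatingMap.compContinuousLinearMap
    (extDerivWithin (localExpr η x) (range I) (extChartAt I x x))
    (mfderiv I 𝓘(ℝ, V) (extChartAt I x) x)

/-- Symplectic forms: smooth, closed, nondegenerate `2`-forms. -/
structure IsSymplecticForm (η : DForm I N 2) : Prop where
  smooth : IsSmoothForm η
  closed : extD η = 0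
  nondegenerate : ∀ (x : N) (u : TangentSpace I x), (∀ v, η x ![u, v] = 0) → u = 0

variable (I N)

/-- The (total space of the) cotangent bundle `T^*N`, as a manifold; a point is a pair `⟨q, p⟩`
with `p` a covector at `q`. -/
abbrev Cotangent : Type _ := TotalSpace (V →L[ℝ] ℝ) (fun x : N => TangentSpace I x →L[ℝ] ℝ)

/-- The model with corners of `T^*N`. -/
abbrev cotangentModel : ModelWithCorners ℝ (V × (V →L[ℝ] ℝ)) (ModelProd H (V →L[ℝ] ℝ)) :=
  I.prod 𝓘(ℝ, V →L[ℝ] ℝ)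

variable {I N} [IsManifold I ∞ N]

/-- The Liouville (tautological) form `λ = p dq` on `T^*N`: `λ_(q,p)(w) = ⟨p, dπ w⟩`, where `π` is
the projection of the cotangent bundle. -/
def liouville : CovectorField (cotangentModel I) (Cotangent I N) :=
  fun x => x.2.comp (mfderiv (cotangentModel I) I (fun y : Cotangent I N => y.proj) x)

variable (I N)

/-- The standard symplectic form `ω = dλ = dp ∧ dq` on `T^*N`. -/
def canonicalForm : DForm (cotangentModel I) (Cotangent I N) 2 :=
  extD (oneForm (liouville (I := I) (N := N)))

variable {I N}

/-- The twisted form `ω + c π^*σ` on `T^*N`. -/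
def twistedForm (c : ℝ) (σ : DForm I N 2) : DForm (cotangentModel I) (Cotangent I N) 2 :=
  canonicalForm I N + c • pullback I (fun y : Cotangent I N => y.proj) σ

end Forms

section CircleBundles

variable {m : ℕ}
  {M : Type*} [TopologicalSpace M] [ChartedSpace (EuclideanSpace ℝ (Fin m)) M]
  [IsManifold (𝓡 m) ∞ M]
  {E : Type*} [TopologicalSpace E] [ChartedSpace (EuclideanSpace ℝ (Fin (m + 1))) E]
  [IsManifold (𝓡 (m + 1)) ∞ E] [MulAction Circle E]

/-- `τ : E → M` is a smooth principal `S¹`-bundle: `S¹` acts smoothly on `E`, preserving the fibres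
of the smooth map `τ`, and there are smooth `S¹`-equivariant local trivializations
`τ⁻¹(U) ≃ U × S¹`. -/
structure IsPrincipalCircleBundle (τ : E → M) : Prop where
  smooth_proj : ContMDiff (𝓡 (m + 1)) (𝓡 m) ∞ τ
  smooth_action : ContMDiffSMul (𝓡 1) (𝓡 (m + 1)) ∞ Circle E
  proj_smul : ∀ (z : Circle) (q : E), τ (z • q) = τ q
  locally_trivial : ∀ b : M, ∃ e : Trivialization Circle τ, b ∈ e.baseSet ∧
    ContMDiffOn (𝓡 (m + 1)) ((𝓡 m).prod (𝓡 1)) ∞ e e.source ∧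
    ContMDiffOn ((𝓡 m).prod (𝓡 1)) (𝓡 (m + 1)) ∞ e.toOpenPartialHomeomorph.symm e.target ∧
    ∀ q ∈ e.source, ∀ z : Circle, (e (z • q)).2 = z * (e q).2

/-- The fundamental vector field `Z_q = d/dt (e^{it} q)` at `t = 0`. (The derivative is a tangent
vector at `e^{i0} q`, which is the point `q`.) -/
def fundamentalField (q : E) : TangentSpace (𝓡 (m + 1)) q :=
  mfderiv 𝓘(ℝ, ℝ) (𝓡 (m + 1)) (fun t : ℝ => Circle.exp t • q) 0 (1 : ℝ)

/-- Connection `1`-forms: smooth, `S¹`-invariant, with `θ(Z) = 1`. -/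
structure IsConnectionForm (θ : CovectorField (𝓡 (m + 1)) E) : Prop where
  smooth : IsSmoothForm (oneForm θ)
  invariant : ∀ (z : Circle) (q : E) (v : TangentSpace (𝓡 (m + 1)) q),
    θ (z • q) (mfderiv (𝓡 (m + 1)) (𝓡 (m + 1)) (fun q' : E => z • q') q v) = θ q v
  apply_fundamentalField : ∀ q : E, θ q (fundamentalField q) = 1

/-- The lift of the circle action to `T^*E`: `z (q, p) = (z q, p ∘ (d_q z)⁻¹)`. -/
def liftedAction (z : Circle) (x : Cotangent (𝓡 (m + 1)) E) : Cotangent (𝓡 (m + 1)) E :=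
  ⟨z • x.proj, x.2.comp
    (mfderiv (𝓡 (m + 1)) (𝓡 (m + 1)) (fun q : E => z • q) x.proj).inverse⟩

/-- The momentum map `A(q, p) = ⟨p, Z_q⟩` of the lifted action. -/
def momentum (x : Cotangent (𝓡 (m + 1)) E) : ℝ := x.2 (fundamentalField x.proj)

variable (m E)

/-- The level set `A⁻¹(c) ⊆ T^*E`, with the subspace topology. -/
abbrev Level (c : ℝ) : Type _ := {x : Cotangent (𝓡 (m + 1)) E // momentum x = c}

/-- The symplectic quotient `T^*E //_c S¹ = A⁻¹(c) / S¹`, with the quotient topology: two points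
of the level set are identified when they lie on one orbit of the lifted action. -/
abbrev SymplecticQuotient (c : ℝ) : Type _ :=
  Quot (fun x y : Level m E c => ∃ z : Circle, liftedAction z x.1 = y.1)

variable {m E}

/-- The inclusion `A⁻¹(c) → T^*E`. -/
def levelIncl (c : ℝ) (x : Level m E c) : Cotangent (𝓡 (m + 1)) E := x.1

/-- The projection `A⁻¹(c) → T^*E //_c S¹`. -/
def quotientProj (c : ℝ) (x : Level m E c) : SymplecticQuotient m E c := Quot.mk _ x

/-- The given charts are the smooth structures of symplectic reduction: `A⁻¹(c)` is an embedded
submanifold of `T^*E`, and the projection `A⁻¹(c) → T^*E //_c S¹` is a submersion of smooth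
manifolds. -/
structure IsReductionStructure (c : ℝ)
    [ChartedSpace (EuclideanSpace ℝ (Fin (2 * m + 1))) (Level m E c)]
    [ChartedSpace (EuclideanSpace ℝ (Fin (2 * m))) (SymplecticQuotient m E c)] : Prop where
  level_manifold : IsManifold (𝓡 (2 * m + 1)) ∞ (Level m E c)
  level_embedded : Manifold.IsSmoothEmbedding (𝓡 (2 * m + 1)) (cotangentModel (𝓡 (m + 1))) ∞
    (levelIncl (m := m) (E := E) c)
  quotient_manifold : IsManifold (𝓡 (2 * m)) ∞ (SymplecticQuotient m E c)
  proj_submersion : Manifold.IsSubmersion (𝓡 (2 * m + 1)) (𝓡 (2 * m)) ∞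
    (quotientProj (m := m) (E := E) c)

/-- The form `ω_c` on the quotient satisfies `pr^* ω_c = ι^* ω`, where `ω` is the standard
symplectic form of `T^*E`. -/
def IsReducedForm (c : ℝ)
    [ChartedSpace (EuclideanSpace ℝ (Fin (2 * m + 1))) (Level m E c)]
    [ChartedSpace (EuclideanSpace ℝ (Fin (2 * m))) (SymplecticQuotient m E c)]
    (ωc : DForm (𝓡 (2 * m)) (SymplecticQuotient m E c) 2) : Prop :=
  (pullback (𝓡 (2 * m)) (quotientProj c) ωc : DForm (𝓡 (2 * m + 1)) (Level m E c) 2) =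
    pullback (cotangentModel (𝓡 (m + 1))) (levelIncl c) (canonicalForm (𝓡 (m + 1)) E)

/-- The implicit equation of `Π_c : A⁻¹(c) → T^*M`: the value at `(q, p)` is the covector `p'` at
`τ q` with `⟨p', d_qτ v⟩ = ⟨p, v⟩ - c θ(v)` for all `v ∈ T_q E`. -/
def IsReducingMap (τ : E → M) (θ : CovectorField (𝓡 (m + 1)) E) (c : ℝ)
    (Pc : Level m E c → Cotangent (𝓡 m) M) : Prop :=
  ∀ x : Level m E c, ∃ p' : TangentSpace (𝓡 m) (τ x.1.proj) →L[ℝ] ℝ, Pc x = ⟨τ x.1.proj, p'⟩ ∧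
    ∀ v : TangentSpace (𝓡 (m + 1)) x.1.proj,
      p' (mfderiv (𝓡 (m + 1)) (𝓡 m) τ x.1.proj v) = x.1.2 v - c * θ x.1.proj v

end CircleBundles

end MagneticReduction

end

open MagneticReduction

/-!
A connection form `θ` splits every covector `p` of `E` at `q` into a multiple of `θ` and a
horizontal covector: `p = (p - A θ) + A θ`, where `A = A(q, p) = ⟨p, Z_q⟩`. The horizontal covector
`p - A θ` vanishes on `Z_q`, which spans the kernel of `d_q τ`, so it descends to a covector of `M`
at `τ q`. This defines a map `P : T^*E → T^*M` (`reduceCotangent`) which restricts to `Π_c` on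
`A⁻¹(c)`. A covector is recovered from its base point, its reduction and its momentum
(`liftCovector`), and two covectors with the same momentum have the same reduction exactly when they
lie on one orbit (`reduceCotangent_eq_iff`). Hence `Π_c` induces a bijection `Φ` from the quotient
to `T^*M`.

Everything is smooth because it is so in local trivializations: over a trivialization `e` of `E`,
the map `X ↦ ((P X, circle coordinate), A X - c)` is a diffeomorphism from an open subset of `T^*E`
to an open subset of `(T^*M × S¹) × ℝ` (`cotangentTriv`). It straightens the level set into the
slice `{0}` of the last factor (`levelTriv`) and the quotient map into the projection to `T^*M`, so
the charts of `T^*M × S¹` and of `T^*M` make `A⁻¹(c)` and the quotient into manifolds with the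
required properties (`exists_isReductionStructure`). For an arbitrary reduction structure, `Φ` is
smooth because the projection is a submersion, and `Φ⁻¹` is smooth because the local sections
`Y ↦ [lift of (Y, 1)]` are smooth into `T^*E`, hence into the embedded submanifold `A⁻¹(c)`
(`quotientDiffeomorph`).

By the definition of `P`, the `1`-forms satisfy `Π_c^*λ̄ = ι^*λ - c θ` on the level set, where `θ`
stands for its pullback (`pullback_liouville`). Taking exterior derivatives and using `dθ = τ^*σ`
gives `Π_c^*(ω̄ + c π̄^*σ) = ι^*ω` (`pullback_twistedForm`). So `Φ^*(ω̄ + c π̄^*σ)` is a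
reduced form; it is the only one because the projection is a surjective submersion
(`pullback_injective`), and it is symplectic because the twisted form is
(`isSymplecticForm_twistedForm`): in canonical coordinates the latter is the standard form plus a
term in the base coordinates only.

Since `TangentSpace I x` is by definition the model vector space, derivatives and covectors at
varying base points are mostly treated as linear maps between the model spaces; the derivative
`d_q τ`, the fundamental field and the components of covectors have names of their own for this
purpose (`dProj`, `fundVec`, `covec`, `fibre`, `covectorCoord`).
-/

noncomputable section

namespace MagneticReduction

set_option linter.unusedSectionVars false

/-! ### Differential forms: pullback and exterior derivative -/

theorem minSmoothness_two_le_infty : minSmoothness ℝ 2 ≤ (∞ : WithTop ℕ∞) := by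
  rw [minSmoothness_of_isRCLikeNormedField]
  exact WithTop.coe_le_coe.2 le_top

section AlternatingMaps

variable {X V W : Type*} [NormedAddCommGroup X] [NormedSpace ℝ X]
  [NormedAddCommGroup V] [NormedSpace ℝ V] [NormedAddCommGroup W] [NormedSpace ℝ W] {k : ℕ}

theorem contDiffOn_alternatingMap_apply {g : X → V [⋀^Fin k]→L[ℝ] ℝ} {v : X → Fin k → V} {s : Set X}
    (hg : ContDiffOn ℝ ∞ g s) (hv : ContDiffOn ℝ ∞ v s) :
    ContDiffOn ℝ ∞ (fun x => g x (v x)) s := by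
  let T : (V [⋀^Fin k]→L[ℝ] ℝ) →L[ℝ] ContinuousMultilinearMap ℝ (fun _ : Fin k => V) ℝ :=
    ContinuousAlternatingMap.toContinuousMultilinearMapCLM ℝ
  have hT : ContDiff ℝ ∞
      (fun p : (V [⋀^Fin k]→L[ℝ] ℝ) × (Fin k → V) => T p.1 p.2) :=
    contDiff_iff_contDiffAt.2 fun p => (T.analyticAt_uncurry_of_multilinear (x := p)).contDiffAt
  exact hT.comp_contDiffOn (hg.prodMk hv)

/-- On a finite-dimensional space, a family of alternating maps is smooth as soon as all its
values on fixed vectors are. -/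
theorem contDiffOn_alternatingMap_of_apply [FiniteDimensional ℝ V]
    {g : X → V [⋀^Fin k]→L[ℝ] ℝ} {s : Set X}
    (h : ∀ v, ContDiffOn ℝ ∞ (fun x => g x v) s) : ContDiffOn ℝ ∞ g s := by
  let b := Module.finBasis ℝ V
  let n := Module.finrank ℝ V
  let T : (V [⋀^Fin k]→L[ℝ] ℝ) →ₗ[ℝ] ((Fin k → Fin n) → ℝ) :=
    { toFun := fun g v => g fun i => b (v i)
      map_add' := fun _ _ => rfl
      map_smul' := fun _ _ => rfl }
  have hT : T.ker = ⊥ := by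
    rw [LinearMap.ker_eq_bot]
    intro g₁ g₂ h12
    apply ContinuousAlternatingMap.toAlternatingMap_injective
    exact b.ext_alternating fun v _ => congrFun h12 v
  obtain ⟨S, hS⟩ := T.exists_leftInverse_of_injective hT
  have hg : g = fun x => S.toContinuousLinearMap (T (g x)) := by
    funext x
    exact (LinearMap.congr_fun hS (g x)).symm
  rw [hg]
  exact S.toContinuousLinearMap.contDiff.comp_contDiffOn (contDiffOn_pi.2 fun v => h _)

theorem contDiffOn_compContinuousLinearMap [FiniteDimensional ℝ W]
    {g : X → V [⋀^Fin k]→L[ℝ] ℝ} {L : X → W →L[ℝ] V} {s : Set X}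
    (hg : ContDiffOn ℝ ∞ g s) (hL : ContDiffOn ℝ ∞ L s) :
    ContDiffOn ℝ ∞ (fun x => (g x).compContinuousLinearMap (L x)) s :=
  contDiffOn_alternatingMap_of_apply fun v =>
    contDiffOn_alternatingMap_apply (v := fun x i => L x (v i)) hg
      (contDiffOn_pi.2 fun _ => hL.clm_apply contDiffOn_const)

end AlternatingMaps

section Forms

variable {V : Type*} [NormedAddCommGroup V] [NormedSpace ℝ V] {H : Type*} [TopologicalSpace H]
  {I : ModelWithCorners ℝ V H} {N : Type*} [TopologicalSpace N] [ChartedSpace H N]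
  {V' : Type*} [NormedAddCommGroup V'] [NormedSpace ℝ V'] {H' : Type*} [TopologicalSpace H']
  {I' : ModelWithCorners ℝ V' H'} {N' : Type*} [TopologicalSpace N'] [ChartedSpace H' N']
  {V'' : Type*} [NormedAddCommGroup V''] [NormedSpace ℝ V''] {H'' : Type*} [TopologicalSpace H'']
  {I'' : ModelWithCorners ℝ V'' H''} {N'' : Type*} [TopologicalSpace N''] [ChartedSpace H'' N'']
  {k : ℕ}

theorem mdifferentiableAt_extChartAt_symm [I.Boundaryless] [IsManifold I 1 N] {x₀ : N} {y : V}
    (hy : y ∈ (extChartAt I x₀).target) :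
    MDifferentiableAt 𝓘(ℝ, V) I (extChartAt I x₀).symm y := by
  have h := mdifferentiableWithinAt_extChartAt_symm (I := I) hy
  rwa [I.range_eq_univ, mdifferentiableWithinAt_univ] at h

theorem mfderiv_extChartAt_symm_comp_mfderiv_extChartAt [I.Boundaryless] [IsManifold I 1 N]
    {x₀ x : N}
(hx : x ∈ (extChartAt I x₀).source) :
    (mfderiv 𝓘(ℝ, V) I (extChartAt I x₀).symm (extChartAt I x₀ x) : V →L[ℝ] V).comp
      (mfderiv I 𝓘(ℝ, V) (extChartAt I x₀) x : V →L[ℝ] V) = ContinuousLinearMap.id ℝ V := by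
  have h := mfderivWithin_extChartAt_symm_comp_mfderiv_extChartAt' (I := I) hx
  rw [I.range_eq_univ, mfderivWithin_univ] at h
  exact h

theorem localExpr_apply [I.Boundaryless] (η : DForm I N k) (x₀ : N) (y : V) (v : Fin k → V) :
    localExpr η x₀ y v = (η ((extChartAt I x₀).symm y) : V [⋀^Fin k]→L[ℝ] ℝ)
      (fun i => (mfderiv 𝓘(ℝ, V) I (extChartAt I x₀).symm y : V →L[ℝ] V) (v i)) := by
  rw [localExpr, I.range_eq_univ, mfderivWithin_univ]
  rfl

/-- The expression of `f` in the preferred charts at `x₀` and `x₁`. -/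
abbrev chartExpr (I : ModelWithCorners ℝ V H) (I' : ModelWithCorners ℝ V' H')
    (f : N → N') (x₀ : N) (x₁ : N') : V → V' :=
  extChartAt I' x₁ ∘ f ∘ (extChartAt I x₀).symm

theorem fderiv_chartExpr [I.Boundaryless] [IsManifold I 1 N] [IsManifold I' 1 N'] {f : N → N'}
    {x₀ : N} {x₁ : N'} {y : V} (hy : y ∈ (extChartAt I x₀).target)
    (hf : MDifferentiableAt I I' f ((extChartAt I x₀).symm y))
    (hfy : f ((extChartAt I x₀).symm y) ∈ (extChartAt I' x₁).source) :
    fderiv ℝ (chartExpr I I' f x₀ x₁) y =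
      (mfderiv I' 𝓘(ℝ, V') (extChartAt I' x₁) (f ((extChartAt I x₀).symm y)) : V' →L[ℝ] V').comp
        ((mfderiv I I' f ((extChartAt I x₀).symm y) : V →L[ℝ] V').comp
          (mfderiv 𝓘(ℝ, V) I (extChartAt I x₀).symm y : V →L[ℝ] V)) := by
  have h1 := mdifferentiableAt_extChartAt_symm (I := I) hy
  have h2 : MDifferentiableAt I' 𝓘(ℝ, V') (extChartAt I' x₁) (f ((extChartAt I x₀).symm y)) :=
    mdifferentiableAt_extChartAt (by simpa using hfy)
  rw [← mfderiv_eq_fderiv, chartExpr, mfderiv_comp y h2 (hf.comp y h1), mfderiv_comp y hf h1]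
  rfl

theorem mfderiv_symm_comp_fderiv_chartExpr [I.Boundaryless] [I'.Boundaryless] [IsManifold I 1 N]
    [IsManifold I' 1 N'] {f : N → N'} {x₀ : N} {x₁ : N'} {y : V} (hy : y ∈ (extChartAt I x₀).target)
    (hf : MDifferentiableAt I I' f ((extChartAt I x₀).symm y))
    (hfy : f ((extChartAt I x₀).symm y) ∈ (extChartAt I' x₁).source) (w : V) :
    (mfderiv 𝓘(ℝ, V') I' (extChartAt I' x₁).symm (chartExpr I I' f x₀ x₁ y) : V' →L[ℝ] V')
      (fderiv ℝ (chartExpr I I' f x₀ x₁) y w) =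
    (mfderiv I I' f ((extChartAt I x₀).symm y) : V →L[ℝ] V')
      ((mfderiv 𝓘(ℝ, V) I (extChartAt I x₀).symm y : V →L[ℝ] V) w) := by
  rw [fderiv_chartExpr hy hf hfy]
  exact DFunLike.congr_fun (mfderiv_extChartAt_symm_comp_mfderiv_extChartAt hfy) _

/-- In charts, the pullback of a form is the pullback of its local expression by the chart
expression of the map. -/
theorem localExpr_pullback [I.Boundaryless] [I'.Boundaryless] [IsManifold I 1 N]
    [IsManifold I' 1 N'] {f : N → N'} (η : DForm I' N' k)
    {x₀ : N} {x₁ : N'} {y : V} (hy : y ∈ (extChartAt I x₀).target)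
    (hf : MDifferentiableAt I I' f ((extChartAt I x₀).symm y))
    (hfy : f ((extChartAt I x₀).symm y) ∈ (extChartAt I' x₁).source) :
    localExpr (pullback I' f η : DForm I N k) x₀ y =
      (localExpr η x₁ (chartExpr I I' f x₀ x₁ y)).compContinuousLinearMap
        (fderiv ℝ (chartExpr I I' f x₀ x₁) y) := by
  ext v
  rw [localExpr_apply, ContinuousAlternatingMap.compContinuousLinearMap_apply, localExpr_apply]
  have h1 : (extChartAt I' x₁).symm (chartExpr I I' f x₀ x₁ y) = f ((extChartAt I x₀).symm y) :=
    (extChartAt I' x₁).left_inv hfy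
  have h2 : (η ((extChartAt I' x₁).symm (chartExpr I I' f x₀ x₁ y)) : V' [⋀^Fin k]→L[ℝ] ℝ) =
      η (f ((extChartAt I x₀).symm y)) := by rw [h1]
  rw [h2]
  exact congrArg (fun w : Fin k → V' => (η (f ((extChartAt I x₀).symm y)) : V' [⋀^Fin k]→L[ℝ] ℝ) w)
    (funext fun i => (mfderiv_symm_comp_fderiv_chartExpr hy hf hfy (v i)).symm)

theorem pullback_id (η : DForm I N k) : (pullback I id η : DForm I N k) = η := by
  funext x
  ext v
  simp only [pullback, mfderiv_id]
  rfl

theorem isOpen_chartExpr_domain [I.Boundaryless] {f : N → N'} (hf : Continuous f) (x₀ : N)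
    (x₁ : N') : IsOpen ((extChartAt I x₀).target ∩
      (extChartAt I x₀).symm ⁻¹' (f ⁻¹' (extChartAt I' x₁).source)) :=
  (continuousOn_extChartAt_symm x₀).isOpen_inter_preimage (isOpen_extChartAt_target x₀)
    ((isOpen_extChartAt_source x₁).preimage hf)

theorem contDiffOn_chartExpr [IsManifold I ∞ N] [IsManifold I' ∞ N'] {f : N → N'}
    (hf : ContMDiff I I' ∞ f) (x₀ : N) (x₁ : N') :
    ContDiffOn ℝ ∞ (chartExpr I I' f x₀ x₁) ((extChartAt I x₀).target ∩
      (extChartAt I x₀).symm ⁻¹' (f ⁻¹' (extChartAt I' x₁).source)) :=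
  (contMDiff_iff.1 hf).2 x₀ x₁

theorem IsSmoothForm.pullback [I.Boundaryless] [I'.Boundaryless] [FiniteDimensional ℝ V]
    [IsManifold I ∞ N] [IsManifold I' ∞ N']
    {f : N → N'} {η : DForm I' N' k} (hη : IsSmoothForm η) (hf : ContMDiff I I' ∞ f) :
    IsSmoothForm (pullback I' f η : DForm I N k) := by
  intro x₀ y hy
  set x₁ := f ((extChartAt I x₀).symm y)
  set D := (extChartAt I x₀).target ∩
      (extChartAt I x₀).symm ⁻¹' (f ⁻¹' (extChartAt I' x₁).source) with hD
  have hDo : IsOpen D := isOpen_chartExpr_domain hf.continuous x₀ x₁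
  have hyD : y ∈ D := ⟨hy, mem_extChartAt_source (I := I') x₁⟩
  have hF := contDiffOn_chartExpr hf x₀ x₁
  have h1 : ContDiffOn ℝ ∞ (fun z =>
      (localExpr η x₁ (chartExpr I I' f x₀ x₁ z)).compContinuousLinearMap
        (fderiv ℝ (chartExpr I I' f x₀ x₁) z)) D := by
    refine contDiffOn_compContinuousLinearMap ((hη x₁).comp hF fun z hz => ?_)
      (hF.fderiv_of_isOpen hDo (by simp))
    exact (extChartAt I' x₁).map_source hz.2
  have h2 := h1.congr fun z (hz : z ∈ D) =>
    localExpr_pullback η hz.1 (hf.mdifferentiable (by simp) _) hz.2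
  exact (h2.contDiffAt (hDo.mem_nhds hyD)).contDiffWithinAt

theorem extD_apply [I.Boundaryless] (η : DForm I N k) (x : N) :
    extD η x = ((extDeriv (localExpr η x) (extChartAt I x x)).compContinuousLinearMap
      (mfderiv I 𝓘(ℝ, V) (extChartAt I x) x : V →L[ℝ] V) : V [⋀^Fin (k + 1)]→L[ℝ] ℝ) := by
  simp only [extD, I.range_eq_univ, extDerivWithin_univ]
  rfl

/-- In arbitrary charts, the exterior derivative commutes with pullback. -/
theorem extDeriv_localExpr_pullback [I.Boundaryless] [I'.Boundaryless] [IsManifold I ∞ N]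
    [IsManifold I' ∞ N']
    {f : N → N'} {η : DForm I' N' k} (hη : IsSmoothForm η) (hf : ContMDiff I I' ∞ f)
    {x₀ : N} {x₁ : N'} {y : V} (hy : y ∈ (extChartAt I x₀).target)
    (hfy : f ((extChartAt I x₀).symm y) ∈ (extChartAt I' x₁).source) :
    extDeriv (localExpr (MagneticReduction.pullback I' f η : DForm I N k) x₀) y =
      (extDeriv (localExpr η x₁) (chartExpr I I' f x₀ x₁ y)).compContinuousLinearMap
        (fderiv ℝ (chartExpr I I' f x₀ x₁) y) := by
  have hDo := isOpen_chartExpr_domain (I := I) (I' := I') hf.continuous x₀ x₁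
  have hyD : y ∈ (extChartAt I x₀).target ∩
      (extChartAt I x₀).symm ⁻¹' (f ⁻¹' (extChartAt I' x₁).source) := ⟨hy, hfy⟩
  have h2 : localExpr (MagneticReduction.pullback I' f η : DForm I N k) x₀ =ᶠ[𝓝 y] fun z =>
      (localExpr η x₁ (chartExpr I I' f x₀ x₁ z)).compContinuousLinearMap
        (fderiv ℝ (chartExpr I I' f x₀ x₁) z) := by
    filter_upwards [hDo.mem_nhds hyD] with z hz
    exact localExpr_pullback η hz.1 (hf.mdifferentiable (by simp) _) hz.2
  rw [h2.extDeriv_eq]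
  refine extDeriv_pullback (r := ∞) ?_ ((contDiffOn_chartExpr hf x₀ x₁).contDiffAt
    (hDo.mem_nhds hyD)) minSmoothness_two_le_infty
  exact ((hη x₁).contDiffAt ((isOpen_extChartAt_target x₁).mem_nhds
    ((extChartAt I' x₁).map_source hfy))).differentiableAt (by simp)

/-- The exterior derivative, defined pointwise in the preferred chart at each point, is computed by
any other chart as well. -/
theorem localExpr_extD [I.Boundaryless] [IsManifold I ∞ N] {η : DForm I N k} (hη : IsSmoothForm η)
    {x₀ : N} {y : V} (hy : y ∈ (extChartAt I x₀).target) :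
    localExpr (extD η) x₀ y = extDeriv (localExpr η x₀) y := by
  have h := extDeriv_localExpr_pullback (f := id) hη contMDiff_id hy
    (mem_extChartAt_source (I := I) ((extChartAt I x₀).symm y))
  rw [pullback_id] at h
  rw [h, fderiv_chartExpr hy mdifferentiableAt_id
    (mem_extChartAt_source (I := I) ((extChartAt I x₀).symm y))]
  ext v
  rw [localExpr_apply, extD_apply]
  simp only [mfderiv_id]
  rfl

theorem extD_pullback [I.Boundaryless] [I'.Boundaryless] [IsManifold I ∞ N] [IsManifold I' ∞ N']
    {f : N → N'} {η : DForm I' N' k} (hη : IsSmoothForm η) (hf : ContMDiff I I' ∞ f) :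
    extD (MagneticReduction.pullback I' f η : DForm I N k) =
      MagneticReduction.pullback I' f (extD η) := by
  funext x
  have hx : (extChartAt I x).symm (extChartAt I x x) = x := extChartAt_to_inv x
  have hfx : f ((extChartAt I x).symm (extChartAt I x x)) ∈ (extChartAt I' (f x)).source := by
    rw [hx]; exact mem_extChartAt_source (I := I') (f x)
  have hy := mem_extChartAt_target (I := I) x
  rw [extD_apply, extDeriv_localExpr_pullback hη hf hy hfx, fderiv_chartExpr hy
    (hf.mdifferentiable (by simp) _) hfx]
  ext v
  rw [MagneticReduction.pullback, extD_apply]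
  have h1 : chartExpr I I' f x (f x) (extChartAt I x x) = extChartAt I' (f x) (f x) := by
    simp only [chartExpr, Function.comp_apply, hx]
  rw [h1, hx]
  have h3 := mfderiv_extChartAt_symm_comp_mfderiv_extChartAt (I := I) (mem_extChartAt_source x)
  refine congrArg (fun w : Fin (k + 1) → V' =>
    extDeriv (localExpr η (f x)) (extChartAt I' (f x) (f x)) w) (funext fun i => ?_)
  exact congrArg (fun w => (mfderiv I' 𝓘(ℝ, V') (extChartAt I' (f x)) (f x) : V' →L[ℝ] V')
    ((mfderiv I I' f x : V →L[ℝ] V') w)) (DFunLike.congr_fun h3 (v i))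

theorem IsSmoothForm.extD [I.Boundaryless] [IsManifold I ∞ N] {η : DForm I N k}
    (hη : IsSmoothForm η) : IsSmoothForm (extD η) := by
  intro x₀
  have ho := isOpen_extChartAt_target (I := I) x₀
  have h : ContDiffOn ℝ ∞ (extDeriv (localExpr η x₀)) (extChartAt I x₀).target :=
    (ContinuousAlternatingMap.alternatizeUncurryFinCLM ℝ V ℝ).contDiff.comp_contDiffOn
      ((hη x₀).fderiv_of_isOpen ho (by simp))
  exact h.congr fun y hy => localExpr_extD hη hy

theorem extD_extD [I.Boundaryless] [IsManifold I ∞ N] {η : DForm I N k}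
    (hη : IsSmoothForm η) : extD (extD η) = 0 := by
  funext x
  have ho := (isOpen_extChartAt_target (I := I) x).mem_nhds (mem_extChartAt_target x)
  have h : localExpr (MagneticReduction.extD η) x =ᶠ[𝓝 (extChartAt I x x)]
      extDeriv (localExpr η x) := by
    filter_upwards [ho] with y hy
    exact localExpr_extD hη hy
  rw [extD_apply, h.extDeriv_eq, extDeriv_extDeriv_apply ((hη x).contDiffAt ho)
    minSmoothness_two_le_infty]
  rfl

theorem localExpr_add (η₁ η₂ : DForm I N k) (x₀ : N) :
    localExpr (η₁ + η₂) x₀ = localExpr η₁ x₀ + localExpr η₂ x₀ := rfl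

theorem localExpr_smul (c : ℝ) (η : DForm I N k) (x₀ : N) :
    localExpr (c • η) x₀ = c • localExpr η x₀ := rfl

theorem IsSmoothForm.add {η₁ η₂ : DForm I N k} (h₁ : IsSmoothForm η₁) (h₂ : IsSmoothForm η₂) :
    IsSmoothForm (η₁ + η₂) := fun x₀ => (h₁ x₀).add (h₂ x₀)

theorem IsSmoothForm.smul (c : ℝ) {η : DForm I N k} (h : IsSmoothForm η) :
    IsSmoothForm (c • η) := fun x₀ => (h x₀).const_smul c

theorem IsSmoothForm.differentiableAt [I.Boundaryless] {η : DForm I N k} (h : IsSmoothForm η)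
    (x : N) : DifferentiableAt ℝ (localExpr η x) (extChartAt I x x) :=
  ((h x).contDiffAt ((isOpen_extChartAt_target (I := I) x).mem_nhds
    (mem_extChartAt_target x))).differentiableAt (by simp)

theorem extD_add [I.Boundaryless] {η₁ η₂ : DForm I N k} (h₁ : IsSmoothForm η₁)
    (h₂ : IsSmoothForm η₂) : extD (η₁ + η₂) = extD η₁ + extD η₂ := by
  funext x
  rw [extD_apply, localExpr_add, extDeriv_add (h₁.differentiableAt x) (h₂.differentiableAt x),
    Pi.add_apply, extD_apply, extD_apply]
  rfl

theorem extD_smul [I.Boundaryless] (c : ℝ) (η : DForm I N k) : extD (c • η) = c • extD η := by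
  funext x
  rw [extD_apply, localExpr_smul, extDeriv_smul, Pi.smul_apply, extD_apply]
  rfl

theorem pullback_add (f : N → N') (η₁ η₂ : DForm I' N' k) :
    (pullback I' f (η₁ + η₂) : DForm I N k) = pullback I' f η₁ + pullback I' f η₂ := rfl

theorem pullback_smul (f : N → N') (c : ℝ) (η : DForm I' N' k) :
    (pullback I' f (c • η) : DForm I N k) = c • pullback I' f η := rfl

theorem pullback_zero (f : N → N') : (pullback I' f (0 : DForm I' N' k) : DForm I N k) = 0 := rfl

theorem pullback_comp {f : N → N'} {g : N' → N''} (hf : MDifferentiable I I' f)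
    (hg : MDifferentiable I' I'' g) (η : DForm I'' N'' k) :
    (pullback I'' (g ∘ f) η : DForm I N k) = pullback I' f (pullback I'' g η : DForm I' N' k) := by
  funext x
  ext v
  simp only [pullback]
  rw [mfderiv_comp x (hg (f x)) (hf x)]
  rfl

theorem IsSymplecticForm.pullback [I.Boundaryless] [I'.Boundaryless] [FiniteDimensional ℝ V]
    [IsManifold I ∞ N] [IsManifold I' ∞ N'] (Φ : Diffeomorph I I' N N' ∞) {η : DForm I' N' 2}
    (hη : IsSymplecticForm η) :
    IsSymplecticForm (MagneticReduction.pullback I' Φ η : DForm I N 2) where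
  smooth := hη.smooth.pullback Φ.contMDiff
  closed := by rw [extD_pullback hη.smooth Φ.contMDiff, hη.closed, pullback_zero]
  nondegenerate x u hu := by
    have hd : MDifferentiableAt I I' Φ x := Φ.contMDiff.mdifferentiable (by simp) x
    have hd' : MDifferentiableAt I' I Φ.symm (Φ x) := Φ.symm.contMDiff.mdifferentiable (by simp) _
    have h1 : (mfderiv I' I Φ.symm (Φ x) : V' →L[ℝ] V).comp (mfderiv I I' Φ x : V →L[ℝ] V') =
        ContinuousLinearMap.id ℝ V := by
      have h := mfderiv_comp x hd' hd
      rw [show (Φ.symm ∘ Φ : N → N) = id from funext Φ.symm_apply_apply, mfderiv_id] at h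
      exact h.symm
    have h2 : (mfderiv I I' Φ x : V →L[ℝ] V').comp (mfderiv I' I Φ.symm (Φ x) : V' →L[ℝ] V) =
        ContinuousLinearMap.id ℝ V' := by
      have hd2 : MDifferentiableAt I I' Φ (Φ.symm (Φ x)) := Φ.contMDiff.mdifferentiable (by simp) _
      have h := mfderiv_comp (Φ x) hd2 hd'
      rw [show (Φ ∘ Φ.symm : N' → N') = id from funext Φ.apply_symm_apply, mfderiv_id,
        Φ.symm_apply_apply] at h
      exact h.symm
    have h3 : (mfderiv I I' Φ x : V →L[ℝ] V') u = 0 := by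
      refine hη.nondegenerate (Φ x) _ fun v => ?_
      have h4 := hu ((mfderiv I' I Φ.symm (Φ x) : V' →L[ℝ] V) v)
      rw [← h4]
      refine congrArg (fun w : Fin 2 → V' => (η (Φ x) : V' [⋀^Fin 2]→L[ℝ] ℝ) w)
        (funext fun i => ?_)
      fin_cases i
      · rfl
      · exact (DFunLike.congr_fun h2 v).symm
    have h5 := DFunLike.congr_fun h1 u
    rw [ContinuousLinearMap.comp_apply, h3, map_zero] at h5
    exact h5.symm

end Forms

/-! ### The cotangent bundle in coordinates -/

section OneForms

variable {X W : Type*} [NormedAddCommGroup X] [NormedSpace ℝ X]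
  [NormedAddCommGroup W] [NormedSpace ℝ W]

theorem contDiffOn_ofSubsingleton_iff {g : X → W →L[ℝ] ℝ} {s : Set X} :
    ContDiffOn ℝ ∞ (fun x => ContinuousAlternatingMap.ofSubsingleton ℝ W ℝ (0 : Fin 1) (g x)) s ↔
      ContDiffOn ℝ ∞ g s :=
  (ContinuousAlternatingMap.ofSubsingletonLIE (𝕜 := ℝ) (E := W) (F := ℝ)
    (0 : Fin 1)).toContinuousLinearEquiv.comp_contDiffOn_iff

theorem extDeriv_ofSubsingleton_linear (l : W →L[ℝ] W →L[ℝ] ℝ) (y : W) (w : Fin 2 → W) :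
    extDeriv (fun x => ContinuousAlternatingMap.ofSubsingleton ℝ W ℝ (0 : Fin 1) (l x)) y w =
      l (w 0) (w 1) - l (w 1) (w 0) := by
  have h := ((ContinuousAlternatingMap.ofSubsingletonLIE (𝕜 := ℝ) (E := W) (F := ℝ)
    (0 : Fin 1)).toContinuousLinearEquiv.toContinuousLinearMap.hasFDerivAt.comp y
      (l.hasFDerivAt (x := y))).fderiv
  rw [extDeriv, show fderiv ℝ (fun x => ContinuousAlternatingMap.ofSubsingleton ℝ W ℝ (0 : Fin 1)
    (l x)) y = _ from h, ContinuousAlternatingMap.alternatizeUncurryFin_apply]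
  simp [Fin.sum_univ_two, Fin.removeNth, ← sub_eq_add_neg]

/-- Linear algebra behind the nondegeneracy of the twisted forms: adding a term that only involves
the `V`-components to the canonical symplectic form of `V × V^*` keeps it nondegenerate. -/
theorem eq_zero_of_canonical_pairing (c : ℝ) (b : W [⋀^Fin 2]→L[ℝ] ℝ) (u : W × (W →L[ℝ] ℝ))
    (h : ∀ v : W × (W →L[ℝ] ℝ), u.2 v.1 - v.2 u.1 + c * b ![u.1, v.1] = 0) : u = 0 := by
  have h1 : u.1 = 0 := by
    refine SeparatingDual.eq_zero_of_forall_dual_eq_zero (R := ℝ) fun f => ?_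
    have h2 := h (0, f)
    have h3 : b ![u.1, 0] = 0 := b.map_coord_zero 1 rfl
    simpa [h3] using h2
  have h2 : u.2 = 0 := by
    ext w
    have h2 := h (w, 0)
    have h3 : b ![0, w] = 0 := b.map_coord_zero 0 rfl
    simpa [h1, h3] using h2
  exact Prod.ext h1 h2

end OneForms

section Cotangent

variable {V : Type*} [NormedAddCommGroup V] [NormedSpace ℝ V] {H : Type*} [TopologicalSpace H]
  {I : ModelWithCorners ℝ V H} {N : Type*} [TopologicalSpace N] [ChartedSpace H N]
  [IsManifold I ∞ N]
  {V' : Type*} [NormedAddCommGroup V'] [NormedSpace ℝ V'] {H' : Type*} [TopologicalSpace H']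
  {I' : ModelWithCorners ℝ V' H'} {N' : Type*} [TopologicalSpace N'] [ChartedSpace H' N']

variable (I) in
/-- The components of a covector at `x` in the preferred chart at `x₀`: the covector precomposed
with the derivative of the inverse chart. -/
def covectorCoord (x₀ x : N) (p : V →L[ℝ] ℝ) : V →L[ℝ] ℝ :=
  p.comp (mfderiv 𝓘(ℝ, V) I (extChartAt I x₀).symm (extChartAt I x₀ x) : V →L[ℝ] V)

/-- The components of a covector are its coordinates in the local trivialization of the cotangent
bundle. -/
theorem inCoordinates_covector [I.Boundaryless] {x₀ x : N} (hx : x ∈ (extChartAt I x₀).source)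
    (p : TangentSpace I x →L[ℝ] ℝ) :
    ContinuousLinearMap.inCoordinates V (TangentSpace I) ℝ (Trivial N ℝ) x₀ x x₀ x p =
      covectorCoord I x₀ x p := by
  have hx' : x ∈ (chartAt H x₀).source := by simpa using hx
  rw [ContinuousLinearMap.inCoordinates, TangentBundle.symmL_trivializationAt hx',
    I.range_eq_univ, mfderivWithin_univ]
  ext v
  simp
  rfl

/-- The preferred charts of `T^*N` are the canonical coordinates associated with those of `N`. -/
theorem extChartAt_cotangent [I.Boundaryless] {X₀ X : Cotangent I N}
    (hX : X.proj ∈ (extChartAt I X₀.proj).source) :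
    extChartAt (cotangentModel I) X₀ X =
      (extChartAt I X₀.proj X.proj, covectorCoord I X₀.proj X.proj X.2) := by
  rw [← inCoordinates_covector hX]
  have h := hom_chart (HB := H) (𝕜 := ℝ) (F₁ := V) (E₁ := (TangentSpace I : N → Type _)) (F₂ := ℝ)
    (E₂ := Trivial N ℝ) X₀ X
  simp only [extChartAt, OpenPartialHomeomorph.extend_coe, Function.comp_apply]
  -- the fibres `T_xN →L ℝ` match those of the bundle of maps into `Trivial N ℝ` up to unfolding
  erw [h]
  rfl

/-- A map into `T^*N` is smooth if and only if its base point and the components of the covector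
are. -/
theorem contMDiffAt_cotangent_iff [I.Boundaryless] {f : N' → Cotangent I N} {y : N'} :
    ContMDiffAt I' (cotangentModel I) ∞ f y ↔ ContMDiffAt I' I ∞ (fun z => (f z).proj) y ∧
      ContMDiffAt I' 𝓘(ℝ, V →L[ℝ] ℝ) ∞
        (fun z => covectorCoord I (f y).proj (f z).proj (f z).2) y := by
  refine (contMDiffAt_hom_bundle (F₁ := V) (E₁ := (TangentSpace I : N → Type _)) (F₂ := ℝ)
    (E₂ := Trivial N ℝ) f).trans (and_congr_right fun h => ?_)
  refine Filter.EventuallyEq.contMDiffAt_iff ?_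
  filter_upwards [h.continuousAt.preimage_mem_nhds (extChartAt_source_mem_nhds (I := I) (f y).proj)]
    with z hz
  exact inCoordinates_covector hz _

theorem cotangent_source (X₀ : Cotangent I N) :
    (extChartAt (cotangentModel I) X₀).source = {X | X.proj ∈ (extChartAt I X₀.proj).source} := by
  ext X
  simp only [FiberBundle.chartedSpace_chartAt, mfld_simps]
  exact ⟨fun h => h.1.1, fun h => ⟨⟨h, trivial⟩, h⟩⟩

theorem contMDiff_proj : ContMDiff (cotangentModel I) I ∞ (fun X : Cotangent I N => X.proj) :=
  Bundle.contMDiff_proj _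

theorem covectorCoord_comp_mfderiv [I.Boundaryless] {x₀ x : N}
    (hx : x ∈ (extChartAt I x₀).source) (p : V →L[ℝ] ℝ) :
    (covectorCoord I x₀ x p).comp (mfderiv I 𝓘(ℝ, V) (extChartAt I x₀) x : V →L[ℝ] V) = p := by
  have : IsManifold I 1 N := .of_le (n := ∞) (by simp)
  have h := mfderiv_extChartAt_symm_comp_mfderiv_extChartAt hx (I := I)
  ext v
  exact congrArg p (DFunLike.congr_fun h v)

/-- The tangent space at `x` is identified with the model space through the preferred chart at `x`,
whose derivative is therefore the identity. -/
theorem mfderiv_chart_self [I.Boundaryless] (x : N) :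
    (mfderiv I 𝓘(ℝ, V) (extChartAt I x) x : V →L[ℝ] V) = ContinuousLinearMap.id ℝ V := by
  have : IsManifold I 1 N := .of_le (n := ∞) (by simp)
  exact mfderiv_extChartAt_self

theorem chartExpr_proj [I.Boundaryless] {X₀ : Cotangent I N} {y : V × (V →L[ℝ] ℝ)}
    (hy : y ∈ (extChartAt (cotangentModel I) X₀).target) :
    chartExpr (cotangentModel I) I (fun X : Cotangent I N => X.proj) X₀ X₀.proj y = y.1 := by
  have h1 := (extChartAt (cotangentModel I) X₀).map_target hy
  rw [cotangent_source] at h1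
  have h2 := extChartAt_cotangent h1
  rw [(extChartAt (cotangentModel I) X₀).right_inv hy] at h2
  exact (congrArg Prod.fst h2).symm

theorem fderiv_chartExpr_proj [I.Boundaryless] {X₀ : Cotangent I N} {y : V × (V →L[ℝ] ℝ)}
    (hy : y ∈ (extChartAt (cotangentModel I) X₀).target) :
    fderiv ℝ (chartExpr (cotangentModel I) I (fun X : Cotangent I N => X.proj) X₀ X₀.proj) y =
      ContinuousLinearMap.fst ℝ V (V →L[ℝ] ℝ) := by
  have h : chartExpr (cotangentModel I) I (fun X : Cotangent I N => X.proj) X₀ X₀.proj =ᶠ[𝓝 y]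
      Prod.fst := by
    filter_upwards [(isOpen_extChartAt_target (I := cotangentModel I) X₀).mem_nhds hy] with z hz
    exact chartExpr_proj hz
  rw [h.fderiv_eq, fderiv_fst]

/-- In the identification of the tangent space of `T^*N` with `V × V^*`, the derivative of the
projection is the first projection. -/
theorem mfderiv_proj [I.Boundaryless] (X : Cotangent I N) :
    (mfderiv (cotangentModel I) I (fun Y : Cotangent I N => Y.proj) X :
      V × (V →L[ℝ] ℝ) →L[ℝ] V) = ContinuousLinearMap.fst ℝ V (V →L[ℝ] ℝ) := by
  have : IsManifold I 1 N := .of_le (n := ∞) (by simp)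
  have : IsManifold (cotangentModel I) 1 (Cotangent I N) := .of_le (n := ∞) (by simp)
  have hX : (extChartAt (cotangentModel I) X).symm (extChartAt (cotangentModel I) X X) = X :=
    extChartAt_to_inv X
  have h := fderiv_chartExpr (I := cotangentModel I) (I' := I)
    (f := fun Y : Cotangent I N => Y.proj) (x₀ := X) (x₁ := X.proj)
    (mem_extChartAt_target X) (contMDiff_proj.mdifferentiable (by simp) _)
    (by rw [hX]; exact mem_extChartAt_source (I := I) _)
  rw [fderiv_chartExpr_proj (mem_extChartAt_target X), hX] at h
  rw [h]
  have h1 := mfderiv_extChartAt_symm_comp_mfderiv_extChartAt (I := cotangentModel I)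
    (mem_extChartAt_source X)
  have h2 := mfderiv_chart_self (I := cotangentModel I) X
  rw [h2] at h1
  rw [mfderiv_chart_self X.proj, show (mfderiv 𝓘(ℝ, V × (V →L[ℝ] ℝ)) (cotangentModel I)
    (extChartAt (cotangentModel I) X).symm (extChartAt (cotangentModel I) X X) :
    V × (V →L[ℝ] ℝ) →L[ℝ] V × (V →L[ℝ] ℝ)) = ContinuousLinearMap.id ℝ _ from h1]
  rfl

/-- The Liouville form in canonical coordinates: `λ_(y,ξ) = ⟨ξ, dy⟩`. -/
theorem localExpr_liouville [I.Boundaryless] {X₀ : Cotangent I N} {y : V × (V →L[ℝ] ℝ)}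
    (hy : y ∈ (extChartAt (cotangentModel I) X₀).target) :
    localExpr (oneForm (liouville (I := I) (N := N))) X₀ y =
      ContinuousAlternatingMap.ofSubsingleton ℝ (V × (V →L[ℝ] ℝ)) ℝ (0 : Fin 1)
        (y.2.comp (ContinuousLinearMap.fst ℝ V (V →L[ℝ] ℝ))) := by
  have : IsManifold I 1 N := .of_le (n := ∞) (by simp)
  have : IsManifold (cotangentModel I) 1 (Cotangent I N) := .of_le (n := ∞) (by simp)
  have h1 := (extChartAt (cotangentModel I) X₀).map_target hy
  rw [cotangent_source] at h1
  set X := (extChartAt (cotangentModel I) X₀).symm y with hX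
  have h2 := extChartAt_cotangent h1
  rw [(extChartAt (cotangentModel I) X₀).right_inv hy] at h2
  have h3 : (y.2).comp (mfderiv I 𝓘(ℝ, V) (extChartAt I X₀.proj) X.proj : V →L[ℝ] V) = X.2 := by
    rw [h2]
    exact covectorCoord_comp_mfderiv h1 _
  have h4 := fderiv_chartExpr (I := cotangentModel I) (I' := I)
    (f := fun Y : Cotangent I N => Y.proj) (x₀ := X₀) (x₁ := X₀.proj)
    hy (contMDiff_proj.mdifferentiable (by simp) _) h1
  rw [fderiv_chartExpr_proj hy] at h4
  ext v
  rw [localExpr_apply, h4]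
  exact (DFunLike.congr_fun h3 _).symm

theorem isSmoothForm_liouville [I.Boundaryless] :
    IsSmoothForm (oneForm (liouville (I := I) (N := N))) := by
  intro X₀
  have h : ContDiffOn ℝ ∞ (fun y : V × (V →L[ℝ] ℝ) =>
      y.2.comp (ContinuousLinearMap.fst ℝ V (V →L[ℝ] ℝ)))
      (extChartAt (cotangentModel I) X₀).target :=
    (contDiff_snd.clm_comp contDiff_const).contDiffOn
  exact (contDiffOn_ofSubsingleton_iff.2 h).congr fun y hy => localExpr_liouville hy

/-- The canonical symplectic form in canonical coordinates. -/
theorem canonicalForm_apply [I.Boundaryless] (X : Cotangent I N) (u v : V × (V →L[ℝ] ℝ)) :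
    canonicalForm I N X ![u, v] = u.2 v.1 - v.2 u.1 := by
  let l : (V × (V →L[ℝ] ℝ)) →L[ℝ] (V × (V →L[ℝ] ℝ)) →L[ℝ] ℝ :=
    ((ContinuousLinearMap.compL ℝ (V × (V →L[ℝ] ℝ)) V ℝ).flip
      (ContinuousLinearMap.fst ℝ V (V →L[ℝ] ℝ))).comp (ContinuousLinearMap.snd ℝ V (V →L[ℝ] ℝ))
  have h : localExpr (oneForm (liouville (I := I) (N := N))) X
      =ᶠ[𝓝 (extChartAt (cotangentModel I) X X)]
        fun y => ContinuousAlternatingMap.ofSubsingleton ℝ _ ℝ (0 : Fin 1) (l y) := by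
    filter_upwards [(isOpen_extChartAt_target (I := cotangentModel I) X).mem_nhds
      (mem_extChartAt_target X)] with z hz
    exact localExpr_liouville hz
  rw [canonicalForm, extD_apply, h.extDeriv_eq, mfderiv_chart_self (I := cotangentModel I) X]
  exact extDeriv_ofSubsingleton_linear l _ ![u, v]

theorem twistedForm_apply [I.Boundaryless] (c : ℝ) (σ : DForm I N 2) (X : Cotangent I N)
    (u v : V × (V →L[ℝ] ℝ)) :
    twistedForm c σ X ![u, v] = u.2 v.1 - v.2 u.1 +
      c * (σ X.proj : V [⋀^Fin 2]→L[ℝ] ℝ) ![u.1, v.1] := by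
  rw [← canonicalForm_apply X u v]
  have h : (pullback I (fun y : Cotangent I N => y.proj) σ : DForm (cotangentModel I) _ 2) X
      ![u, v] =
      (σ X.proj : V [⋀^Fin 2]→L[ℝ] ℝ) ![u.1, v.1] := by
    refine congrArg (fun w : Fin 2 → V => (σ X.proj : V [⋀^Fin 2]→L[ℝ] ℝ) w) (funext fun i => ?_)
    have h1 := mfderiv_proj X
    fin_cases i
    · exact DFunLike.congr_fun h1 u
    · exact DFunLike.congr_fun h1 v
  rw [← h]
  rfl

theorem isSymplecticForm_twistedForm [I.Boundaryless] [FiniteDimensional ℝ V] (c : ℝ)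
    {σ : DForm I N 2} (hσ : IsSmoothForm σ) (hσ' : extD σ = 0) :
    IsSymplecticForm (twistedForm c σ) where
  smooth := isSmoothForm_liouville.extD.add ((hσ.pullback contMDiff_proj).smul c)
  closed := by
    rw [twistedForm, canonicalForm,
      extD_add isSmoothForm_liouville.extD ((hσ.pullback contMDiff_proj).smul c),
      extD_extD isSmoothForm_liouville, extD_smul, extD_pullback hσ contMDiff_proj, hσ',
      pullback_zero, smul_zero, add_zero]
  nondegenerate X u hu := by
    have h (v : V × (V →L[ℝ] ℝ)) := (twistedForm_apply c σ X u v).symm.trans (hu v)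
    exact eq_zero_of_canonical_pairing (W := V) c (σ X.proj : V [⋀^Fin 2]→L[ℝ] ℝ) u h

end Cotangent

/-! ### Manifold structures from local models -/

section LocalModels

variable {V : Type*} [NormedAddCommGroup V] [NormedSpace ℝ V] {H : Type*} [TopologicalSpace H]
  (J : ModelWithCorners ℝ V H) [J.Boundaryless] {Y : Type*} [TopologicalSpace Y] [ChartedSpace H Y]
  {V' : Type*} [NormedAddCommGroup V'] [NormedSpace ℝ V'] (κ : V ≃L[ℝ] V')

/-- The preferred chart of `Y` at `y`, with the model space replaced by a vector space isomorphic to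
the one on which `Y` is modelled. -/
def modelChart (y : Y) : OpenPartialHomeomorph Y V' :=
  (chartAt H y).transHomeomorph (J.toHomeomorph.trans κ.toHomeomorph)

theorem contMDiffOn_modelChart [IsManifold J ∞ Y] (y : Y) :
    ContMDiffOn J 𝓘(ℝ, V') ∞ (modelChart J κ y) (modelChart J κ y).source :=
  κ.contDiff.contMDiff.comp_contMDiffOn (contMDiffOn_extChartAt (I := J))

theorem contMDiffOn_modelChart_symm [IsManifold J ∞ Y] (y : Y) :
    ContMDiffOn 𝓘(ℝ, V') J ∞ (modelChart J κ y).symm (modelChart J κ y).target := by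
  refine (contMDiffOn_extChartAt_symm (I := J) y).comp κ.symm.contDiff.contMDiff.contMDiffOn ?_
  intro v hv
  rw [mem_preimage, extChartAt_target]
  refine ⟨hv, ?_⟩
  rw [J.range_eq_univ]
  trivial

variable {X : Type*} [TopologicalSpace X] (L : X → OpenPartialHomeomorph X Y)
  (hL : ∀ x, x ∈ (L x).source)

/-- The charts on `X` obtained from local homeomorphisms `L x` (around each point `x` of `X`) to
the manifold `Y`. -/
abbrev chartedSpaceOfLocalModels : ChartedSpace V' X where
  atlas := range fun x => (L x).trans (modelChart J κ (L x x))
  chartAt x := (L x).trans (modelChart J κ (L x x))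
  mem_chart_source x := by
    rw [OpenPartialHomeomorph.trans_source]
    exact ⟨hL x, mem_chart_source H _⟩
  chart_mem_atlas x := mem_range_self x

/-- The charts obtained from local models are compatible if the transition maps between the models
are smooth. -/
theorem isManifold_of_localModels [IsManifold J ∞ Y]
    (h : ∀ x x', ContMDiffOn J J ∞ ((L x).symm.trans (L x')) ((L x).symm.trans (L x')).source) :
    @IsManifold ℝ _ V' _ _ V' _ 𝓘(ℝ, V') ∞ X _ (chartedSpaceOfLocalModels J κ L hL) := by
  let _ : ChartedSpace V' X := chartedSpaceOfLocalModels J κ L hL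
  refine isManifold_of_contDiffOn _ _ _ ?_
  rintro _ _ ⟨x, rfl⟩ ⟨x', rfl⟩
  simp only [modelWithCornersSelf_coe, modelWithCornersSelf_coe_symm, Function.id_comp,
    Function.comp_id, preimage_id, range_id, inter_univ]
  rw [← contMDiffOn_iff_contDiffOn]
  refine (contMDiffOn_modelChart J κ (L x' x')).comp (t := _)
    ((h x x').comp ((contMDiffOn_modelChart_symm J κ (L x x)).mono ?_) ?_) ?_
  all_goals
    intro v hv
    simp only [mfld_simps] at hv ⊢
    tauto

end LocalModels

section LocalModelMaps

variable {V : Type*} [NormedAddCommGroup V] [NormedSpace ℝ V] {H : Type*} [TopologicalSpace H]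
  (J : ModelWithCorners ℝ V H) [J.Boundaryless] {Y : Type*} [TopologicalSpace Y] [ChartedSpace H Y]
  [IsManifold J ∞ Y]
  {W : Type*} [NormedAddCommGroup W] [NormedSpace ℝ W] {K : Type*} [TopologicalSpace K]
  (J' : ModelWithCorners ℝ W K) [J'.Boundaryless] {S : Type*} [TopologicalSpace S]
  [ChartedSpace K S] [IsManifold J' ∞ S]
  {V' : Type*} [NormedAddCommGroup V'] [NormedSpace ℝ V']
  {X : Type*} [TopologicalSpace X]

omit [IsManifold J' ∞ S] [J'.Boundaryless] in
/-- A diffeomorphism from an open subset of `N` to an open subset of `Y`, followed by a chart of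
`Y`, is a chart of `N`. -/
theorem mem_maximalAtlas_of_localModel
    {U : Type*} [NormedAddCommGroup U] [NormedSpace ℝ U] {H₁ : Type*} [TopologicalSpace H₁]
    {I : ModelWithCorners ℝ U H₁} [I.Boundaryless] {N : Type*} [TopologicalSpace N]
    [ChartedSpace H₁ N] [IsManifold I ∞ N] (κ : V ≃L[ℝ] U) {G : OpenPartialHomeomorph N Y}
    (hG : ContMDiffOn I J ∞ G G.source) (hG' : ContMDiffOn J I ∞ G.symm G.target) (y : Y) :
    (G.trans (modelChart J κ y)).transHomeomorph I.toHomeomorph.symm ∈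
      IsManifold.maximalAtlas I ∞ N := by
  refine OpenPartialHomeomorph.mem_maximalAtlas_of_contMDiffOn _ ?_ ?_
  · have h : ContMDiffOn I 𝓘(ℝ, U) ∞ (G.trans (modelChart J κ y))
        (G.trans (modelChart J κ y)).source :=
      (contMDiffOn_modelChart J κ y).comp (hG.mono inter_subset_left) inter_subset_right
    refine (ModelWithCorners.contMDiffOn_symm (I := I)).comp h fun v _ => ?_
    rw [I.range_eq_univ]
    trivial
  · have h : ContMDiffOn 𝓘(ℝ, U) I ∞ (G.trans (modelChart J κ y)).symm
        (G.trans (modelChart J κ y)).target :=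
      hG'.comp ((contMDiffOn_modelChart_symm J κ y).mono inter_subset_left) inter_subset_right
    exact h.comp (ModelWithCorners.contMDiff (I := I)).contMDiffOn fun v hv => hv

omit [IsManifold J ∞ Y] in
theorem chartAt_symm_localModel (κ : V ≃L[ℝ] V') (L : X → OpenPartialHomeomorph X Y)
    (hL : ∀ x, x ∈ (L x).source) {x : X} {v : V'}
    (hv : v ∈ ((chartedSpaceOfLocalModels J κ L hL).chartAt x).target) :
    ((chartedSpaceOfLocalModels J κ L hL).chartAt x).symm v ∈ (L x).source ∧
      extChartAt J (L x x) (L x (((chartedSpaceOfLocalModels J κ L hL).chartAt x).symm v)) =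
        κ.symm v := by
  let A := (chartedSpaceOfLocalModels J κ L hL).chartAt x
  have h1 : A.symm v ∈ A.source := A.map_target hv
  have h2 : κ (extChartAt J (L x x) (L x (A.symm v))) = v := A.right_inv hv
  refine ⟨?_, κ.injective (h2.trans (κ.apply_symm_apply v).symm)⟩
  change _ ∈ ((L x).trans (modelChart J κ (L x x))).source at h1
  rw [OpenPartialHomeomorph.trans_source] at h1
  exact h1.1

/-- A map which in local models is the inclusion `y ↦ (y, s₀)` is an immersion. -/
theorem isImmersionOfComplement_of_localModels {κ : V ≃L[ℝ] V'} {L : X → OpenPartialHomeomorph X Y}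
    (hL : ∀ x, x ∈ (L x).source)
    (hLL : ∀ x x', ContMDiffOn J J ∞ ((L x).symm.trans (L x')) ((L x).symm.trans (L x')).source)
    {U : Type*} [NormedAddCommGroup U] [NormedSpace ℝ U] {H₁ : Type*} [TopologicalSpace H₁]
    {I : ModelWithCorners ℝ U H₁} [I.Boundaryless] {N : Type*} [TopologicalSpace N]
    [ChartedSpace H₁ N] [IsManifold I ∞ N] (κ' : (V × W) ≃L[ℝ] U)
    {f : X → N} (hf : Continuous f) (G : X → OpenPartialHomeomorph N (Y × S)) (s₀ : S)
    (hG : ∀ x, ContMDiffOn I (J.prod J') ∞ (G x) (G x).source)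
    (hG' : ∀ x, ContMDiffOn (J.prod J') I ∞ (G x).symm (G x).target)
    (hxG : ∀ x, f x ∈ (G x).source)
    (hGL : ∀ x, ∀ x' ∈ (L x).source, G x (f x') = (L x x', s₀))
    (hs₀ : extChartAt J' s₀ s₀ = 0) :
    letI := chartedSpaceOfLocalModels J κ L hL
    Manifold.IsImmersionOfComplement W 𝓘(ℝ, V') I ∞ f := by
  let _ : ChartedSpace V' X := chartedSpaceOfLocalModels J κ L hL
  have : IsManifold 𝓘(ℝ, V') ∞ X := isManifold_of_localModels J κ L hL hLL
  intro x
  have hGx : G x (f x) = (L x x, s₀) := hGL x x (hL x)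
  refine Manifold.IsImmersionAtOfComplement.mk_of_continuousAt hf.continuousAt
    ((κ.symm.prodCongr (ContinuousLinearEquiv.refl ℝ W)).trans κ') (chartAt V' x)
    (((G x).trans (modelChart (J.prod J') κ' (L x x, s₀))).transHomeomorph I.toHomeomorph.symm)
    (mem_chart_source V' x) ?_ (IsManifold.chart_mem_maximalAtlas x) ?_ ?_
  · change f x ∈ ((G x).trans (modelChart (J.prod J') κ' (L x x, s₀))).source
    rw [OpenPartialHomeomorph.trans_source]
    refine ⟨hxG x, ?_⟩
    rw [mem_preimage, hGx]
    exact mem_chart_source (ModelProd H K) (L x x, s₀)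
  · exact mem_maximalAtlas_of_localModel (J.prod J') κ' (hG x) (hG' x) _
  · intro v hv
    simp only [mfld_simps] at hv
    obtain ⟨h1, h2⟩ := chartAt_symm_localModel J κ L hL hv
    change I (I.symm (κ' (extChartAt (J.prod J') (L x x, s₀) (G x (f ((chartAt V' x).symm v)))))) =
      κ' (κ.symm v, 0)
    rw [I.right_inv (by rw [I.range_eq_univ]; trivial), hGL x _ h1, extChartAt_prod, ← h2]
    exact congrArg (fun s => κ' (_, s)) hs₀

/-- A map which in local models is the projection `(y, s) ↦ y` is a submersion. -/
theorem isSubmersionOfComplement_of_localModels {κ : (V × W) ≃L[ℝ] V'}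
    {L : X → OpenPartialHomeomorph X (Y × S)} (hL : ∀ x, x ∈ (L x).source)
    (hLL : ∀ x x', ContMDiffOn (J.prod J') (J.prod J') ∞ ((L x).symm.trans (L x'))
      ((L x).symm.trans (L x')).source)
    {U : Type*} [NormedAddCommGroup U] [NormedSpace ℝ U] {Q : Type*} [TopologicalSpace Q]
    {κ' : V ≃L[ℝ] U} {L' : Q → OpenPartialHomeomorph Q Y} (hL' : ∀ x, x ∈ (L' x).source)
    (hLL' : ∀ x x', ContMDiffOn J J ∞ ((L' x).symm.trans (L' x'))
      ((L' x).symm.trans (L' x')).source)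
    {f : X → Q} (hf : Continuous f)
    (hfL : ∀ x, ∀ x' ∈ (L x).source, L' (f x) (f x') = (L x x').1) :
    letI := chartedSpaceOfLocalModels (J.prod J') κ L hL
    letI := chartedSpaceOfLocalModels J κ' L' hL'
    Manifold.IsSubmersionOfComplement W 𝓘(ℝ, V') 𝓘(ℝ, U) ∞ f := by
  let _ : ChartedSpace V' X := chartedSpaceOfLocalModels (J.prod J') κ L hL
  let _ : ChartedSpace U Q := chartedSpaceOfLocalModels J κ' L' hL'
  have : IsManifold 𝓘(ℝ, V') ∞ X := isManifold_of_localModels _ κ L hL hLL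
  have : IsManifold 𝓘(ℝ, U) ∞ Q := isManifold_of_localModels _ κ' L' hL' hLL'
  intro x
  refine Manifold.IsSubmersionAtOfComplement.mk_of_continuousAt hf.continuousAt
    (κ.symm.trans (κ'.prodCongr (ContinuousLinearEquiv.refl ℝ W))) (chartAt V' x)
    (chartAt U (f x)) (mem_chart_source V' x) (mem_chart_source U (f x))
    (IsManifold.chart_mem_maximalAtlas x) (IsManifold.chart_mem_maximalAtlas (f x)) ?_
  intro v hv
  simp only [mfld_simps] at hv
  obtain ⟨h1, h2⟩ := chartAt_symm_localModel (J.prod J') κ L hL hv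
  change κ' (extChartAt J (L' (f x) (f x)) (L' (f x) (f ((chartAt V' x).symm v)))) =
    κ' (κ.symm v).1
  rw [hfL x _ h1, hfL x x (hL x), ← h2, extChartAt_prod]
  rfl

end LocalModelMaps

/-! ### Smooth families of covectors -/

section CovectorCoord

variable {V : Type*} [NormedAddCommGroup V] [NormedSpace ℝ V] {H : Type*} [TopologicalSpace H]
  {I : ModelWithCorners ℝ V H} {N : Type*} [TopologicalSpace N] [ChartedSpace H N]
  {V' : Type*} [NormedAddCommGroup V'] [NormedSpace ℝ V'] {H' : Type*} [TopologicalSpace H']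
  {I' : ModelWithCorners ℝ V' H'} {N' : Type*} [TopologicalSpace N'] [ChartedSpace H' N']

/-- The components of a smooth field of covectors are smooth. -/
theorem contMDiffAt_covectorCoord [I.Boundaryless] [IsManifold I ∞ N] {α : CovectorField I N}
    (hα : IsSmoothForm (oneForm α)) {x₀ x : N} (hx : x ∈ (extChartAt I x₀).source) :
    ContMDiffAt I 𝓘(ℝ, V →L[ℝ] ℝ) ∞ (fun z => covectorCoord I x₀ z (α z)) x := by
  let g : V → V →L[ℝ] ℝ := fun y => (α ((extChartAt I x₀).symm y) : V →L[ℝ] ℝ).comp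
    (mfderiv 𝓘(ℝ, V) I (extChartAt I x₀).symm y : V →L[ℝ] V)
  have h1 : ContDiffOn ℝ ∞ g (extChartAt I x₀).target := by
    rw [← contDiffOn_ofSubsingleton_iff]
    refine (hα x₀).congr fun y _ => ?_
    ext v
    rw [localExpr_apply]
    rfl
  have h2 : ContMDiffOn I 𝓘(ℝ, V →L[ℝ] ℝ) ∞ (g ∘ extChartAt I x₀) (extChartAt I x₀).source := by
    refine (contMDiffOn_iff_contDiffOn.2 h1).comp ?_ fun z hz => (extChartAt I x₀).map_source hz
    rw [extChartAt_source]
    exact contMDiffOn_extChartAt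
  refine (h2.contMDiffAt ((isOpen_extChartAt_source x₀).mem_nhds hx)).congr_of_eventuallyEq ?_
  filter_upwards [(isOpen_extChartAt_source (I := I) x₀).mem_nhds hx] with z hz
  simp only [g, Function.comp_apply, covectorCoord]
  rw [(extChartAt I x₀).left_inv hz]
  rfl

/-- Pulling back covectors is smooth: if `F` is a smooth family of maps, and `Y` a smooth family of
covectors at the points `F w (g w)`, then the covectors `Y w ∘ d(F w)` at `g w` have smooth
components. -/
theorem contMDiffAt_covectorCoord_comp_mfderiv [I.Boundaryless] [I'.Boundaryless] [IsManifold I ∞ N]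
    [IsManifold I' ∞ N']
    {V'' : Type*} [NormedAddCommGroup V''] [NormedSpace ℝ V''] {H'' : Type*} [TopologicalSpace H'']
    {I'' : ModelWithCorners ℝ V'' H''} {Q : Type*} [TopologicalSpace Q] [ChartedSpace H'' Q]
    [IsManifold I'' ∞ Q]
    {F : Q → N → N'} {g : Q → N} {Y : Q → Cotangent I' N'} {z : Q}
    (hF : ContMDiffAt (I''.prod I) I' ∞ (Function.uncurry F) (z, g z))
    (hg : ContMDiffAt I'' I ∞ g z) (hY : ContMDiffAt I'' (cotangentModel I') ∞ Y z)
    (hYg : ∀ᶠ w in 𝓝 z, (Y w).proj = F w (g w)) :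
    ContMDiffAt I'' 𝓘(ℝ, V →L[ℝ] ℝ) ∞ (fun w => covectorCoord I (g z) (g w)
      ((Y w).2.comp (mfderiv I I' (F w) (g w) : V →L[ℝ] V'))) z := by
  have : IsManifold I 1 N := .of_le (n := ∞) (by simp)
  have : IsManifold I' 1 N' := .of_le (n := ∞) (by simp)
  obtain ⟨hY1, hY2⟩ := contMDiffAt_cotangent_iff.1 hY
  have hz : (Y z).proj = F z (g z) := hYg.self_of_nhds
  have h1 := ContMDiffAt.mfderiv F g hF hg (m := ∞) (by simp)
  refine (hY2.clm_comp h1).congr_of_eventuallyEq ?_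
  have hFg : ContinuousAt (fun w => F w (g w)) z :=
    ContinuousAt.comp (g := Function.uncurry F) (f := fun w => (w, g w)) hF.continuousAt
      (continuousAt_id.prodMk hg.continuousAt)
  filter_upwards [hYg, hg.continuousAt.preimage_mem_nhds
    (extChartAt_source_mem_nhds (I := I) (g z)),
    hFg.preimage_mem_nhds (extChartAt_source_mem_nhds (I := I') (F z (g z)))] with w hw1 hw2 hw3
  have hw2' : g w ∈ (chartAt H (g z)).source := by simpa using hw2
  have hw3' : F w (g w) ∈ (chartAt H' (F z (g z))).source := by simpa using hw3
  have h2 := mfderiv_extChartAt_symm_comp_mfderiv_extChartAt hw3 (I := I')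
  unfold inTangentCoordinates ContinuousLinearMap.inCoordinates
  beta_reduce
  rw [TangentBundle.symmL_trivializationAt hw2', I.range_eq_univ, mfderivWithin_univ,
    TangentBundle.continuousLinearMapAt_trivializationAt hw3', hz, hw1]
  ext v
  exact congrArg (Y w).2 (DFunLike.congr_fun h2 _).symm

end CovectorCoord

/-! ### Geometry of principal circle bundles -/

section Geometry

variable {m : ℕ}
  {M : Type*} [TopologicalSpace M] [ChartedSpace (EuclideanSpace ℝ (Fin m)) M]
  {E : Type*} [TopologicalSpace E] [ChartedSpace (EuclideanSpace ℝ (Fin (m + 1))) E]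
  [MulAction Circle E]

/-- The derivative `d_q τ`, as a linear map between the model spaces. -/
def dProj (τ : E → M) (q : E) :
    EuclideanSpace ℝ (Fin (m + 1)) →L[ℝ] EuclideanSpace ℝ (Fin m) :=
  mfderiv (𝓡 (m + 1)) (𝓡 m) τ q

/-- The fundamental field at `q`, as an element of the model space. -/
def fundVec (q : E) : EuclideanSpace ℝ (Fin (m + 1)) := fundamentalField q

theorem circleExp_zero_smul {E : Type*} [MulAction Circle E] (q : E) : Circle.exp 0 • q = q := by
  rw [Circle.exp_zero, one_smul]

theorem IsPrincipalCircleBundle.contMDiff_exp_smul {τ : E → M}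
    (hτ : IsPrincipalCircleBundle (m := m) τ) :
    ContMDiff ((𝓡 (m + 1)).prod 𝓘(ℝ, ℝ)) (𝓡 (m + 1)) ∞
      (fun p : E × ℝ => Circle.exp p.2 • p.1) := by
  have := hτ.smooth_action
  exact (ContMDiffSMul.contMDiff_smul (I := 𝓡 1) (I' := 𝓡 (m + 1)) (n := ∞) (G := Circle)
    (M := E)).comp
    ((contMDiff_circleExp.comp contMDiff_snd).prodMk contMDiff_fst)

theorem IsPrincipalCircleBundle.dProj_fundVec {τ : E → M}
    (hτ : IsPrincipalCircleBundle (m := m) τ) (q : E) :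
    dProj (m := m) τ q (fundVec (m := m) q) = 0 := by
  have h1 : MDifferentiableAt 𝓘(ℝ, ℝ) (𝓡 (m + 1)) (fun t : ℝ => Circle.exp t • q) 0 :=
    (hτ.contMDiff_exp_smul.comp (contMDiff_const.prodMk contMDiff_id)).mdifferentiable (by simp) _
  have h2 := mfderiv_comp (0 : ℝ) (hτ.smooth_proj.mdifferentiable (by simp) (Circle.exp 0 • q)) h1
  have h3 : (τ ∘ fun t : ℝ => Circle.exp t • q) = fun _ => τ q := funext fun t => hτ.proj_smul _ _
  rw [h3, mfderiv_const, circleExp_zero_smul] at h2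
  exact (DFunLike.congr_fun h2 (1 : ℝ)).symm

/-- The local trivializations required by `IsPrincipalCircleBundle`: smooth in both directions and
equivariant. -/
structure IsSmoothTrivialization {τ : E → M} (e : Trivialization Circle τ) : Prop where
  smooth : ContMDiffOn (𝓡 (m + 1)) ((𝓡 m).prod (𝓡 1)) ∞ e e.source
  smooth_symm : ContMDiffOn ((𝓡 m).prod (𝓡 1)) (𝓡 (m + 1)) ∞
    e.toOpenPartialHomeomorph.symm e.target
  equivariant : ∀ q ∈ e.source, ∀ z : Circle, (e (z • q)).2 = z * (e q).2

theorem IsPrincipalCircleBundle.exists_trivialization {τ : E → M}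
    (hτ : IsPrincipalCircleBundle (m := m) τ) (b : M) :
    ∃ e : Trivialization Circle τ, b ∈ e.baseSet ∧ IsSmoothTrivialization (m := m) e := by
  obtain ⟨e, hb, h1, h2, h3⟩ := hτ.locally_trivial b
  exact ⟨e, hb, h1, h2, h3⟩

/-- The horizontal lift of tangent vectors given by a local trivialization: the derivative of the
local section through `q` that is constant in the trivialization. -/
def flatLift {τ : E → M} (e : Trivialization Circle τ) (q : E) :
    EuclideanSpace ℝ (Fin m) →L[ℝ] EuclideanSpace ℝ (Fin (m + 1)) :=
  mfderiv (𝓡 m) (𝓡 (m + 1)) (fun b => e.toOpenPartialHomeomorph.symm (b, (e q).2)) (τ q)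

/-- The sections in the definition of `flatLift` depend smoothly on the point and the parameter. -/
theorem IsSmoothTrivialization.contMDiffAt_section {τ : E → M} {e : Trivialization Circle τ}
    (he : IsSmoothTrivialization (m := m) e) {q : E} (hq : q ∈ e.source) :
    ContMDiffAt ((𝓡 (m + 1)).prod (𝓡 m)) (𝓡 (m + 1)) ∞
      (fun p : E × M => e.toOpenPartialHomeomorph.symm (p.2, (e p.1).2)) (q, τ q) := by
  have hq' : (τ q, (e q).2) ∈ e.target := e.mem_target.2 (e.mem_source.1 hq)
  have h1 : ContMDiffAt ((𝓡 (m + 1)).prod (𝓡 m)) ((𝓡 m).prod (𝓡 1)) ∞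
      (fun p : E × M => (p.2, (e p.1).2)) (q, τ q) := by
    refine contMDiffAt_snd.prodMk ?_
    have h2 : ContMDiffAt (𝓡 (m + 1)) ((𝓡 m).prod (𝓡 1)) ∞ e q :=
      he.smooth.contMDiffAt (e.open_source.mem_nhds hq)
    have h3 : ContMDiffAt (𝓡 (m + 1)) (𝓡 1) ∞ (fun q => (e q).2) q := contMDiffAt_snd.comp q h2
    exact ContMDiffAt.comp (q, τ q) (g := fun q => (e q).2) h3 contMDiffAt_fst
  exact (he.smooth_symm.contMDiffAt (e.open_target.mem_nhds hq')).comp (q, τ q) h1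

theorem IsSmoothTrivialization.dProj_comp_flatLift {τ : E → M}
    (hτ : IsPrincipalCircleBundle (m := m) τ) {e : Trivialization Circle τ}
    (he : IsSmoothTrivialization (m := m) e) {q : E} (hq : q ∈ e.source) :
    (dProj (m := m) τ q).comp (flatLift (m := m) e q) = ContinuousLinearMap.id ℝ _ := by
  have h0 : e.toOpenPartialHomeomorph.symm (τ q, (e q).2) = q := e.symm_apply_mk_proj hq
  have h1 : MDifferentiableAt (𝓡 m) (𝓡 (m + 1))
      (fun b => e.toOpenPartialHomeomorph.symm (b, (e q).2)) (τ q) :=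
    ((he.contMDiffAt_section hq).comp (τ q)
      (contMDiffAt_const.prodMk contMDiffAt_id)).mdifferentiableAt (by simp)
  have h2 := mfderiv_comp (τ q) (hτ.smooth_proj.mdifferentiable (by simp) _) h1
  have h3 : (τ ∘ fun b => e.toOpenPartialHomeomorph.symm (b, (e q).2)) =ᶠ[𝓝 (τ q)] id := by
    filter_upwards [e.open_baseSet.mem_nhds (e.mem_source.1 hq)] with b hb
    exact e.proj_symm_apply (e.mem_target.2 hb)
  rw [h3.mfderiv_eq, mfderiv_id, h0] at h2
  exact h2.symm

end Geometry

/-! ### Splitting covectors of a circle bundle -/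

section Flat

variable {V : Type*} [NormedAddCommGroup V] [NormedSpace ℝ V] {H : Type*} [TopologicalSpace H]
  {I : ModelWithCorners ℝ V H} {N : Type*} [TopologicalSpace N] [ChartedSpace H N]

/-- The value of a field of covectors, as a linear functional on the model space. -/
def covec (α : CovectorField I N) (x : N) : V →L[ℝ] ℝ := α x

/-- The covector underlying a point of `T^*N`, as a linear functional on the model space. -/
def fibre (X : Cotangent I N) : V →L[ℝ] ℝ := X.2

end Flat

section Reduction

variable {m : ℕ}
  {M : Type*} [TopologicalSpace M] [ChartedSpace (EuclideanSpace ℝ (Fin m)) M]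
  [IsManifold (𝓡 m) ∞ M]
  {E : Type*} [TopologicalSpace E] [ChartedSpace (EuclideanSpace ℝ (Fin (m + 1))) E]
  [IsManifold (𝓡 (m + 1)) ∞ E] [MulAction Circle E]

theorem IsConnectionForm.covec_fundVec {θ : CovectorField (𝓡 (m + 1)) E}
    (hθ : IsConnectionForm θ) (q : E) : covec θ q (fundVec (m := m) q) = 1 :=
  hθ.apply_fundamentalField q

theorem IsPrincipalCircleBundle.exists_trivialization_mem_source {τ : E → M}
    (hτ : IsPrincipalCircleBundle (m := m) τ) (q : E) :
    ∃ e : Trivialization Circle τ, q ∈ e.source ∧ IsSmoothTrivialization (m := m) e := by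
  obtain ⟨e, he, he'⟩ := hτ.exists_trivialization (τ q)
  exact ⟨e, e.mem_source.2 he, he'⟩

theorem IsPrincipalCircleBundle.dProj_surjective {τ : E → M}
    (hτ : IsPrincipalCircleBundle (m := m) τ) (q : E) :
    Function.Surjective (dProj (m := m) τ q) := by
  obtain ⟨e, hq, he⟩ := hτ.exists_trivialization_mem_source q
  exact fun w => ⟨flatLift e q w, DFunLike.congr_fun (he.dProj_comp_flatLift hτ hq) w⟩

/-- The vertical tangent space at `q` is spanned by the fundamental field, and `θ` is the coordinate
on it. -/
theorem IsPrincipalCircleBundle.eq_smul_fundVec {τ : E → M}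
    (hτ : IsPrincipalCircleBundle (m := m) τ) {θ : CovectorField (𝓡 (m + 1)) E}
    (hθ : IsConnectionForm θ) (q : E) {v : EuclideanSpace ℝ (Fin (m + 1))}
    (hv : dProj τ q v = 0) : v = covec θ q v • fundVec q := by
  let D : EuclideanSpace ℝ (Fin (m + 1)) →ₗ[ℝ] EuclideanSpace ℝ (Fin m) :=
    (dProj (m := m) τ q).toLinearMap
  let Z := fundVec (m := m) q
  let t := covec θ q
  have ht : t Z = 1 := hθ.apply_fundamentalField q
  have hD : Function.Surjective D := hτ.dProj_surjective q
  have hZ : Z ∈ D.ker := hτ.dProj_fundVec q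
  have h1 : Module.finrank ℝ D.ker = 1 := by
    have h := D.finrank_range_add_finrank_ker
    rw [LinearMap.range_eq_top.2 hD, finrank_top] at h
    simp only [finrank_euclideanSpace, Fintype.card_fin] at h
    omega
  have hZ0 : (⟨Z, hZ⟩ : D.ker) ≠ 0 := by
    intro h
    have h0 : Z = 0 := congrArg Subtype.val h
    rw [h0, map_zero] at ht
    exact zero_ne_one ht
  obtain ⟨a, ha⟩ := (finrank_eq_one_iff_of_nonzero' _ hZ0).1 h1 ⟨v, hv⟩
  have hav : a • Z = v := congrArg Subtype.val ha
  have h2 : t v = a := by rw [← hav, map_smul, ht, smul_eq_mul, mul_one]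
  change v = t v • Z
  rw [h2, hav]

/-- A linear right inverse of `d_q τ`, chosen without regard to smoothness in `q`: in the definition of the
reduction of a covector, any other right inverse may be substituted for it. -/
def horizontalLift (τ : E → M) (q : E) :
    EuclideanSpace ℝ (Fin m) →L[ℝ] EuclideanSpace ℝ (Fin (m + 1)) :=
  Classical.epsilon fun R => (dProj τ q).comp R = ContinuousLinearMap.id ℝ _

theorem IsPrincipalCircleBundle.dProj_comp_horizontalLift {τ : E → M}
    (hτ : IsPrincipalCircleBundle (m := m) τ) (q : E) :
    (dProj (m := m) τ q).comp (horizontalLift τ q) = ContinuousLinearMap.id ℝ _ := by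
  obtain ⟨e, hq, he⟩ := hτ.exists_trivialization_mem_source q
  exact Classical.epsilon_spec (p := fun R => (dProj τ q).comp R = ContinuousLinearMap.id ℝ _)
    ⟨_, he.dProj_comp_flatLift hτ hq⟩

/-- The horizontal part `p - A(q, p) θ` of a covector `(q, p)` of `E`. -/
def horizontalPart (θ : CovectorField (𝓡 (m + 1)) E) (X : Cotangent (𝓡 (m + 1)) E) :
    EuclideanSpace ℝ (Fin (m + 1)) →L[ℝ] ℝ :=
  fibre X - momentum X • covec θ X.proj

/-- The extension of the reducing map to all of `T^*E`: the horizontal part of a covector,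
regarded as a covector of `M`. -/
def reduceCotangent (τ : E → M) (θ : CovectorField (𝓡 (m + 1)) E)
    (X : Cotangent (𝓡 (m + 1)) E) : Cotangent (𝓡 m) M :=
  ⟨τ X.proj, (horizontalPart θ X).comp (horizontalLift τ X.proj)⟩

/-- The covector at `q` with horizontal part `ξ ∘ d_q τ` and momentum `a`. -/
def liftCovector (τ : E → M) (θ : CovectorField (𝓡 (m + 1)) E) (q : E)
    (ξ : EuclideanSpace ℝ (Fin m) →L[ℝ] ℝ) (a : ℝ) : Cotangent (𝓡 (m + 1)) E :=
  ⟨q, ξ.comp (dProj τ q) + a • covec θ q⟩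

theorem horizontalPart_eq_zero {τ : E → M}
    (hτ : IsPrincipalCircleBundle (m := m) τ) {θ : CovectorField (𝓡 (m + 1)) E}
    (hθ : IsConnectionForm θ) (X : Cotangent (𝓡 (m + 1)) E) {v : EuclideanSpace ℝ (Fin (m + 1))}
    (hv : dProj τ X.proj v = 0) : horizontalPart θ X v = 0 := by
  rw [hτ.eq_smul_fundVec hθ X.proj hv, map_smul]
  have h : horizontalPart θ X (fundVec X.proj) =
      momentum X - momentum X * covec θ X.proj (fundVec X.proj) := rfl
  rw [h, hθ.covec_fundVec, mul_one, sub_self, smul_zero]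

/-- Since the horizontal part vanishes on `ker d_q τ`, it factors through `d_q τ`, and any right
inverse of `d_q τ` exhibits the factorization. -/
theorem horizontalPart_comp_of_rightInverse {τ : E → M}
    (hτ : IsPrincipalCircleBundle (m := m) τ) {θ : CovectorField (𝓡 (m + 1)) E}
    (hθ : IsConnectionForm θ) (X : Cotangent (𝓡 (m + 1)) E)
    {R : EuclideanSpace ℝ (Fin m) →L[ℝ] EuclideanSpace ℝ (Fin (m + 1))}
    (hR : (dProj τ X.proj).comp R = ContinuousLinearMap.id ℝ _)
    (v : EuclideanSpace ℝ (Fin (m + 1))) :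
    horizontalPart θ X (R (dProj τ X.proj v)) = horizontalPart θ X v := by
  rw [← sub_eq_zero, ← map_sub]
  apply horizontalPart_eq_zero hτ hθ
  rw [map_sub, sub_eq_zero]
  exact DFunLike.congr_fun hR _

theorem reduceCotangent_apply {τ : E → M}
    (hτ : IsPrincipalCircleBundle (m := m) τ) {θ : CovectorField (𝓡 (m + 1)) E}
    (hθ : IsConnectionForm θ) (X : Cotangent (𝓡 (m + 1)) E) (v : EuclideanSpace ℝ (Fin (m + 1))) :
    fibre (reduceCotangent τ θ X) (dProj τ X.proj v) = horizontalPart θ X v :=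
  horizontalPart_comp_of_rightInverse hτ hθ X (hτ.dProj_comp_horizontalLift _) v

/-- The reduction is characterized by its implicit equation, as `d_q τ` is surjective. -/
theorem eq_reduceCotangent {τ : E → M}
    (hτ : IsPrincipalCircleBundle (m := m) τ) {θ : CovectorField (𝓡 (m + 1)) E}
    (hθ : IsConnectionForm θ) (X : Cotangent (𝓡 (m + 1)) E) (p : EuclideanSpace ℝ (Fin m) →L[ℝ] ℝ)
    (hp : ∀ v, p ((dProj τ X.proj) v) = horizontalPart θ X v) :
    (⟨τ X.proj, p⟩ : Cotangent (𝓡 m) M) = reduceCotangent τ θ X := by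
  have h : p = (fibre (reduceCotangent τ θ X)) := by
    ext w
    obtain ⟨v, rfl⟩ := hτ.dProj_surjective X.proj w
    exact (hp v).trans (reduceCotangent_apply hτ hθ X v).symm
  rw [h]
  rfl

theorem momentum_liftCovector {τ : E → M}
    (hτ : IsPrincipalCircleBundle (m := m) τ) {θ : CovectorField (𝓡 (m + 1)) E}
    (hθ : IsConnectionForm θ) (q : E) (ξ : EuclideanSpace ℝ (Fin m) →L[ℝ] ℝ) (a : ℝ) :
    momentum (liftCovector τ θ q ξ a) = a := by
  have h1 := hτ.dProj_fundVec q
  have h2 := hθ.covec_fundVec q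
  have h : momentum (liftCovector τ θ q ξ a) = ξ ((dProj τ q) (fundVec q)) +
      a * covec θ q (fundVec q) := rfl
  rw [h, h1, h2, map_zero, zero_add, mul_one]

theorem horizontalPart_liftCovector {τ : E → M}
    (hτ : IsPrincipalCircleBundle (m := m) τ) {θ : CovectorField (𝓡 (m + 1)) E}
    (hθ : IsConnectionForm θ) (q : E) (ξ : EuclideanSpace ℝ (Fin m) →L[ℝ] ℝ) (a : ℝ) :
    horizontalPart θ (liftCovector τ θ q ξ a) = ξ.comp (dProj τ q) := by
  rw [horizontalPart, momentum_liftCovector hτ hθ]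
  exact add_sub_cancel_right _ _

theorem reduceCotangent_liftCovector {τ : E → M}
    (hτ : IsPrincipalCircleBundle (m := m) τ) {θ : CovectorField (𝓡 (m + 1)) E}
    (hθ : IsConnectionForm θ) {q : E} {Y : Cotangent (𝓡 m) M} (hq : τ q = Y.proj) (a : ℝ) :
    reduceCotangent τ θ (liftCovector τ θ q (fibre Y) a) = Y := by
  obtain ⟨b, p⟩ := Y
  obtain rfl : τ q = b := hq
  refine (eq_reduceCotangent hτ hθ (liftCovector τ θ q p a) p fun v => ?_).symm
  exact (DFunLike.congr_fun (horizontalPart_liftCovector hτ hθ q p a) v).symm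

/-- A covector is recovered from its base point, its reduction and its momentum. -/
theorem liftCovector_reduceCotangent {τ : E → M}
    (hτ : IsPrincipalCircleBundle (m := m) τ) {θ : CovectorField (𝓡 (m + 1)) E}
    (hθ : IsConnectionForm θ) (X : Cotangent (𝓡 (m + 1)) E) :
    liftCovector τ θ X.proj (fibre (reduceCotangent τ θ X)) (momentum X) = X := by
  obtain ⟨q, p⟩ := X
  have h : (fibre (reduceCotangent τ θ ⟨q, p⟩)).comp (dProj τ q) +
      momentum ⟨q, p⟩ • covec θ q = p := by
    ext v
    have h1 := reduceCotangent_apply hτ hθ ⟨q, p⟩ v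
    refine (congrArg (· + momentum ⟨q, p⟩ * covec θ q v) h1).trans ?_
    exact sub_add_cancel _ _
  exact congrArg (TotalSpace.mk q) h

theorem contMDiff_momentum {τ : E → M} (hτ : IsPrincipalCircleBundle (m := m) τ) :
    ContMDiff (cotangentModel (𝓡 (m + 1))) 𝓘(ℝ, ℝ) ∞ (momentum : Cotangent (𝓡 (m + 1)) E → ℝ) := by
  intro X₀
  -- the momentum at `(q, p)` is the pullback of `p` under the orbit map `t ↦ e^{it} q`, at `t = 0`
  have h := contMDiffAt_covectorCoord_comp_mfderiv (I := 𝓘(ℝ, ℝ)) (z := X₀)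
    (F := fun (X : Cotangent (𝓡 (m + 1)) E) (t : ℝ) => Circle.exp t • X.proj) (g := fun _ => 0)
    (Y := id) ?_ contMDiffAt_const contMDiffAt_id
    (Filter.Eventually.of_forall fun X => (circleExp_zero_smul X.proj).symm)
  · refine (h.clm_apply (contMDiffAt_const (c := (1 : ℝ)))).congr_of_eventuallyEq
      (Filter.Eventually.of_forall fun X => ?_)
    have h2 : (mfderiv 𝓘(ℝ, ℝ) 𝓘(ℝ, ℝ) (id : ℝ → ℝ) (id 0) : ℝ →L[ℝ] ℝ) 1 = 1 := by
      rw [mfderiv_id]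
      rfl
    exact (congrArg (fun s => X.2 (mfderiv 𝓘(ℝ, ℝ) (𝓡 (m + 1))
      (fun t : ℝ => Circle.exp t • X.proj) 0 s)) h2).symm
  · exact (hτ.contMDiff_exp_smul.comp
      ((contMDiff_proj.comp contMDiff_fst).prodMk contMDiff_snd)).contMDiffAt

theorem contMDiff_horizontalPart {τ : E → M} (hτ : IsPrincipalCircleBundle (m := m) τ)
    {θ : CovectorField (𝓡 (m + 1)) E} (hθ : IsConnectionForm θ) :
    ContMDiff (cotangentModel (𝓡 (m + 1))) (cotangentModel (𝓡 (m + 1))) ∞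
      (fun X => (⟨X.proj, horizontalPart θ X⟩ : Cotangent (𝓡 (m + 1)) E)) := by
  intro X₀
  have h0 : ContMDiffAt (cotangentModel (𝓡 (m + 1))) (𝓡 (m + 1)) ∞
    (fun X : Cotangent (𝓡 (m + 1)) E => X.proj) X₀ := contMDiff_proj.contMDiffAt
  rw [contMDiffAt_cotangent_iff]
  refine ⟨h0, ?_⟩
  have h1 := (contMDiffAt_cotangent_iff.1 (contMDiffAt_id (x := X₀))).2
  have h2 := (contMDiffAt_covectorCoord hθ.smooth
    (mem_extChartAt_source (I := 𝓡 (m + 1)) X₀.proj)).comp X₀ h0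
  exact h1.sub ((contMDiff_momentum hτ X₀).smul h2)

theorem contMDiff_reduceCotangent {τ : E → M}
    (hτ : IsPrincipalCircleBundle (m := m) τ) {θ : CovectorField (𝓡 (m + 1)) E}
    (hθ : IsConnectionForm θ) :
    ContMDiff (cotangentModel (𝓡 (m + 1))) (cotangentModel (𝓡 m)) ∞ (reduceCotangent τ θ) := by
  intro X₀
  obtain ⟨e, he, he'⟩ := hτ.exists_trivialization_mem_source X₀.proj
  have h0 : ContMDiffAt (cotangentModel (𝓡 (m + 1))) (𝓡 (m + 1)) ∞
    (fun X : Cotangent (𝓡 (m + 1)) E => X.proj) X₀ := contMDiff_proj.contMDiffAt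
  have h1 : ContMDiffAt (cotangentModel (𝓡 (m + 1))) (𝓡 m) ∞
    (fun X : Cotangent (𝓡 (m + 1)) E => τ X.proj) X₀ := hτ.smooth_proj.contMDiffAt.comp X₀ h0
  have hs : ∀ᶠ X : Cotangent (𝓡 (m + 1)) E in 𝓝 X₀, X.proj ∈ e.source :=
    h0.continuousAt.preimage_mem_nhds (e.open_source.mem_nhds he)
  rw [contMDiffAt_cotangent_iff]
  refine ⟨h1, ?_⟩
  -- near `X₀`, the lift in the definition may be replaced by the flat lift
  have h2 := contMDiffAt_covectorCoord_comp_mfderiv (z := X₀) (I := 𝓡 m)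
    (F := fun (X : Cotangent (𝓡 (m + 1)) E) (b : M) =>
      e.toOpenPartialHomeomorph.symm (b, (e X.proj).2)) (g := fun X => τ X.proj)
    ?_ h1 (contMDiff_horizontalPart hτ hθ X₀)
    (hs.mono fun X hX => (e.symm_apply_mk_proj hX).symm)
  · refine h2.congr_of_eventuallyEq (hs.mono fun X hX => ?_)
    refine congrArg (covectorCoord (𝓡 m) (τ X₀.proj) (τ X.proj)) ?_
    ext w
    exact (congrArg (fun u => horizontalPart θ X (horizontalLift τ X.proj u))
      (DFunLike.congr_fun (he'.dProj_comp_flatLift hτ hX) w)).symm.trans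
      (horizontalPart_comp_of_rightInverse hτ hθ X (hτ.dProj_comp_horizontalLift X.proj)
        (flatLift e X.proj w))
  · exact (he'.contMDiffAt_section he).comp (X₀, τ X₀.proj)
      (f := fun p : Cotangent (𝓡 (m + 1)) E × M => (p.1.proj, p.2))
      ((contMDiff_proj.contMDiffAt.comp (X₀, τ X₀.proj) contMDiffAt_fst).prodMk contMDiffAt_snd)

theorem contMDiffAt_liftCovector {τ : E → M}
    (hτ : IsPrincipalCircleBundle (m := m) τ) {θ : CovectorField (𝓡 (m + 1)) E}
    (hθ : IsConnectionForm θ)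
    {V : Type*} [NormedAddCommGroup V] [NormedSpace ℝ V] {H : Type*} [TopologicalSpace H]
    {I : ModelWithCorners ℝ V H} {Q : Type*} [TopologicalSpace Q] [ChartedSpace H Q]
    [IsManifold I ∞ Q]
    {f : Q → E} {Y : Q → Cotangent (𝓡 m) M} {a : Q → ℝ} {z : Q}
    (hf : ContMDiffAt I (𝓡 (m + 1)) ∞ f z) (hY : ContMDiffAt I (cotangentModel (𝓡 m)) ∞ Y z)
    (hYf : ∀ᶠ w in 𝓝 z, (Y w).proj = τ (f w)) (ha : ContMDiffAt I 𝓘(ℝ, ℝ) ∞ a z) :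
    ContMDiffAt I (cotangentModel (𝓡 (m + 1))) ∞
      (fun w => liftCovector τ θ (f w) (fibre (Y w)) (a w)) z := by
  rw [contMDiffAt_cotangent_iff]
  refine ⟨hf, ?_⟩
  have h1 := contMDiffAt_covectorCoord_comp_mfderiv (F := fun _ => τ)
    (hτ.smooth_proj.contMDiffAt.comp (z, f z) contMDiffAt_snd) hf hY hYf
  have h2 := (contMDiffAt_covectorCoord hθ.smooth
    (mem_extChartAt_source (I := 𝓡 (m + 1)) (f z))).comp z hf
  exact h1.add (ha.smul h2)

end Reduction

/-! ### Local trivializations of the cotangent bundle and of the level sets -/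

section CotangentTrivialization

variable {m : ℕ}
  {M : Type*} [TopologicalSpace M] [ChartedSpace (EuclideanSpace ℝ (Fin m)) M]
  [IsManifold (𝓡 m) ∞ M]
  {E : Type*} [TopologicalSpace E] [ChartedSpace (EuclideanSpace ℝ (Fin (m + 1))) E]
  [IsManifold (𝓡 (m + 1)) ∞ E] [MulAction Circle E]

/-- The model with corners of `T^*M × S¹`. -/
abbrev cotangentCircleModel (m : ℕ) := (cotangentModel (𝓡 m)).prod (𝓡 1)

/-- The point of `T^*E` with reduction `Y`, circle coordinate `z` in the trivialization `e`, and
momentum `a`. -/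
def trivLift {τ : E → M} (e : Trivialization Circle τ) (θ : CovectorField (𝓡 (m + 1)) E)
    (p : Cotangent (𝓡 m) M × Circle) (a : ℝ) : Cotangent (𝓡 (m + 1)) E :=
  liftCovector τ θ (e.toOpenPartialHomeomorph.symm (p.1.proj, p.2)) (fibre p.1) a

/-- The reduction and the circle coordinate of a point of `T^*E`. -/
def trivCoord {τ : E → M} (e : Trivialization Circle τ) (θ : CovectorField (𝓡 (m + 1)) E)
    (X : Cotangent (𝓡 (m + 1)) E) : Cotangent (𝓡 m) M × Circle :=
  (reduceCotangent τ θ X, (e X.proj).2)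

variable {τ : E → M} {e : Trivialization Circle τ} {θ : CovectorField (𝓡 (m + 1)) E}

theorem trivCoord_trivLift (hτ : IsPrincipalCircleBundle (m := m) τ) (hθ : IsConnectionForm θ)
    {p : Cotangent (𝓡 m) M × Circle} (hp : p.1.proj ∈ e.baseSet) (a : ℝ) :
    trivCoord e θ (trivLift e θ p a) = p := by
  have hp' : (p.1.proj, p.2) ∈ e.target := e.mem_target.2 hp
  refine Prod.ext (reduceCotangent_liftCovector hτ hθ (e.proj_symm_apply hp') a) ?_
  exact congrArg (fun r : M × Circle => r.2) (e.apply_symm_apply hp')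

theorem momentum_trivLift (hτ : IsPrincipalCircleBundle (m := m) τ) (hθ : IsConnectionForm θ)
    (p : Cotangent (𝓡 m) M × Circle) (a : ℝ) : momentum (trivLift e θ p a) = a :=
  momentum_liftCovector hτ hθ _ _ _

theorem trivLift_trivCoord (hτ : IsPrincipalCircleBundle (m := m) τ) (hθ : IsConnectionForm θ)
    {X : Cotangent (𝓡 (m + 1)) E} (hX : X.proj ∈ e.source) :
    trivLift e θ (trivCoord e θ X) (momentum X) = X := by
  have h : e.toOpenPartialHomeomorph.symm (τ X.proj, (e X.proj).2) = X.proj :=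
    e.symm_apply_mk_proj hX
  refine Eq.trans ?_ (liftCovector_reduceCotangent hτ hθ X)
  exact congrArg (fun q => liftCovector τ θ q (fibre (reduceCotangent τ θ X)) (momentum X)) h

theorem trivLift_proj_mem_source {p : Cotangent (𝓡 m) M × Circle} (hp : p.1.proj ∈ e.baseSet)
    (a : ℝ) : (trivLift e θ p a).proj ∈ e.source :=
  e.toOpenPartialHomeomorph.map_target (e.mem_target.2 hp)

theorem contMDiffAt_trivCoord (hτ : IsPrincipalCircleBundle (m := m) τ) (hθ : IsConnectionForm θ)
    (he : IsSmoothTrivialization (m := m) e) {X : Cotangent (𝓡 (m + 1)) E}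
    (hX : X.proj ∈ e.source) :
    ContMDiffAt (cotangentModel (𝓡 (m + 1))) (cotangentCircleModel m) ∞ (trivCoord e θ) X := by
  have h1 : ContMDiffAt (𝓡 (m + 1)) ((𝓡 m).prod (𝓡 1)) ∞ e X.proj :=
    he.smooth.contMDiffAt (e.open_source.mem_nhds hX)
  have h2 : ContMDiffAt (cotangentModel (𝓡 (m + 1))) ((𝓡 m).prod (𝓡 1)) ∞
      (fun X : Cotangent (𝓡 (m + 1)) E => e X.proj) X := h1.comp X contMDiff_proj.contMDiffAt
  exact (contMDiff_reduceCotangent hτ hθ X).prodMk (contMDiffAt_snd.comp X h2)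

theorem contMDiffAt_trivLift (hτ : IsPrincipalCircleBundle (m := m) τ) (hθ : IsConnectionForm θ)
    (he : IsSmoothTrivialization (m := m) e) {p : Cotangent (𝓡 m) M × Circle}
    (hp : p.1.proj ∈ e.baseSet) (a : ℝ) :
    ContMDiffAt ((cotangentCircleModel m).prod 𝓘(ℝ, ℝ)) (cotangentModel (𝓡 (m + 1))) ∞
      (fun r : (Cotangent (𝓡 m) M × Circle) × ℝ => trivLift e θ r.1 r.2) (p, a) := by
  have hp' : (p.1.proj, p.2) ∈ e.target := e.mem_target.2 hp
  have h1 : ContMDiffAt ((cotangentCircleModel m).prod 𝓘(ℝ, ℝ)) ((𝓡 m).prod (𝓡 1)) ∞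
      (fun r : (Cotangent (𝓡 m) M × Circle) × ℝ => (r.1.1.proj, r.1.2)) (p, a) :=
    ((contMDiff_proj.comp (contMDiff_fst.comp contMDiff_fst)).prodMk
      (contMDiff_snd.comp contMDiff_fst)).contMDiffAt
  refine contMDiffAt_liftCovector hτ hθ (Q := (Cotangent (𝓡 m) M × Circle) × ℝ)
    (f := fun r => e.toOpenPartialHomeomorph.symm (r.1.1.proj, r.1.2)) (Y := fun r => r.1.1)
    (a := fun r => r.2) ?_ ?_ ?_ contMDiffAt_snd
  · exact (he.smooth_symm.contMDiffAt (e.open_target.mem_nhds hp')).comp (p, a) h1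
  · exact (contMDiff_fst.comp contMDiff_fst).contMDiffAt
  · filter_upwards [h1.continuousAt.preimage_mem_nhds (e.open_target.mem_nhds hp')] with r hr
    exact (e.proj_symm_apply hr).symm

variable (M) in
theorem isOpen_proj_preimage (s : Set M) (hs : IsOpen s) :
    IsOpen {p : Cotangent (𝓡 m) M × Circle | p.1.proj ∈ s} :=
  hs.preimage ((contMDiff_proj (I := 𝓡 m) (N := M)).continuous.comp continuous_fst)

/-- The local trivialization `X ↦ (reduction, circle coordinate, momentum - c)` of `T^*E` over a
trivialization of `E`. -/
def cotangentTriv (hτ : IsPrincipalCircleBundle (m := m) τ) (hθ : IsConnectionForm θ)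
    (he : IsSmoothTrivialization (m := m) e) (c : ℝ) :
    OpenPartialHomeomorph (Cotangent (𝓡 (m + 1)) E) ((Cotangent (𝓡 m) M × Circle) × ℝ) where
  toFun X := (trivCoord e θ X, momentum X - c)
  invFun r := trivLift e θ r.1 (r.2 + c)
  source := {X | X.proj ∈ e.source}
  target := {r | r.1.1.proj ∈ e.baseSet}
  map_source' _ hX := e.mem_source.1 hX
  map_target' _ hr := trivLift_proj_mem_source hr _
  left_inv' X hX := by rw [sub_add_cancel]; exact trivLift_trivCoord hτ hθ hX
  right_inv' r hr := Prod.ext (trivCoord_trivLift hτ hθ hr _) (by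
    change momentum (trivLift e θ _ _) - c = r.2
    rw [momentum_trivLift hτ hθ, add_sub_cancel_right])
  open_source := e.open_source.preimage contMDiff_proj.continuous
  open_target := (isOpen_proj_preimage M _ e.open_baseSet).preimage continuous_fst
  continuousOn_toFun X hX := ((contMDiffAt_trivCoord hτ hθ he hX).continuousAt.prodMk
    ((contMDiff_momentum hτ).continuous.continuousAt.sub continuousAt_const)).continuousWithinAt
  continuousOn_invFun r hr := by
    have h := (contMDiffAt_trivLift (m := m) hτ hθ he hr (r.2 + c)).continuousAt
    exact (ContinuousAt.comp (f := fun r : (Cotangent (𝓡 m) M × Circle) × ℝ => (r.1, r.2 + c)) h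
      (by fun_prop)).continuousWithinAt

theorem contMDiffOn_cotangentTriv (hτ : IsPrincipalCircleBundle (m := m) τ)
    (hθ : IsConnectionForm θ) (he : IsSmoothTrivialization (m := m) e) (c : ℝ) :
    ContMDiffOn (cotangentModel (𝓡 (m + 1))) ((cotangentCircleModel m).prod 𝓘(ℝ, ℝ)) ∞
      (cotangentTriv hτ hθ he c) (cotangentTriv hτ hθ he c).source := fun X hX =>
  ((contMDiffAt_trivCoord hτ hθ he hX).prodMk
    ((contMDiff_momentum hτ X).sub contMDiffAt_const)).contMDiffWithinAt

theorem contMDiffOn_cotangentTriv_symm (hτ : IsPrincipalCircleBundle (m := m) τ)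
    (hθ : IsConnectionForm θ) (he : IsSmoothTrivialization (m := m) e) (c : ℝ) :
    ContMDiffOn ((cotangentCircleModel m).prod 𝓘(ℝ, ℝ)) (cotangentModel (𝓡 (m + 1))) ∞
      (cotangentTriv hτ hθ he c).symm (cotangentTriv hτ hθ he c).target := fun r hr => by
  have h := contMDiffAt_trivLift (m := m) hτ hθ he hr (r.2 + c)
  exact (ContMDiffAt.comp r
    (f := fun r : (Cotangent (𝓡 m) M × Circle) × ℝ => (r.1, r.2 + c)) h
    (contMDiffAt_fst.prodMk (contMDiffAt_snd.add contMDiffAt_const))).contMDiffWithinAt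

theorem contMDiffAt_trivLift_const (hτ : IsPrincipalCircleBundle (m := m) τ)
    (hθ : IsConnectionForm θ) (he : IsSmoothTrivialization (m := m) e)
    {p : Cotangent (𝓡 m) M × Circle} (hp : p.1.proj ∈ e.baseSet) (c : ℝ) :
    ContMDiffAt (cotangentCircleModel m) (cotangentModel (𝓡 (m + 1))) ∞
      (fun p : Cotangent (𝓡 m) M × Circle => trivLift e θ p c) p :=
  ContMDiffAt.comp p (f := fun p : Cotangent (𝓡 m) M × Circle => (p, c))
    (contMDiffAt_trivLift hτ hθ he hp c) (contMDiffAt_id.prodMk contMDiffAt_const)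

/-- The local trivialization `X ↦ (reduction, circle coordinate)` of the level set `A⁻¹(c)` over a
trivialization of `E`. -/
def levelTriv (hτ : IsPrincipalCircleBundle (m := m) τ) (hθ : IsConnectionForm θ)
    (he : IsSmoothTrivialization (m := m) e) (c : ℝ) :
    OpenPartialHomeomorph (Level m E c) (Cotangent (𝓡 m) M × Circle) where
  toFun x := trivCoord e θ x.1
  invFun p := ⟨trivLift e θ p c, momentum_trivLift hτ hθ p c⟩
  source := {x | x.1.proj ∈ e.source}
  target := {p | p.1.proj ∈ e.baseSet}
  map_source' _ hx := e.mem_source.1 hx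
  map_target' _ hp := trivLift_proj_mem_source hp _
  left_inv' x hx := Subtype.ext (by
    have h := trivLift_trivCoord hτ hθ hx
    rwa [x.2] at h)
  right_inv' p hp := trivCoord_trivLift hτ hθ hp _
  open_source := e.open_source.preimage (contMDiff_proj.continuous.comp continuous_subtype_val)
  open_target := isOpen_proj_preimage M _ e.open_baseSet
  continuousOn_toFun x hx := (ContinuousAt.comp (g := trivCoord e θ)
    (contMDiffAt_trivCoord hτ hθ he hx).continuousAt
    continuous_subtype_val.continuousAt).continuousWithinAt
  continuousOn_invFun p hp := by
    refine Topology.IsInducing.subtypeVal.continuousWithinAt_iff.2 ?_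
    exact (contMDiffAt_trivLift_const hτ hθ he hp c).continuousAt.continuousWithinAt

theorem contMDiffOn_levelTriv_trans (hτ : IsPrincipalCircleBundle (m := m) τ)
    (hθ : IsConnectionForm θ) (he : IsSmoothTrivialization (m := m) e)
    {e' : Trivialization Circle τ} (he' : IsSmoothTrivialization (m := m) e') (c : ℝ) :
    ContMDiffOn (cotangentCircleModel m) (cotangentCircleModel m) ∞
      ((levelTriv hτ hθ he c).symm.trans (levelTriv hτ hθ he' c))
      ((levelTriv hτ hθ he c).symm.trans (levelTriv hτ hθ he' c)).source := fun p hp => by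
  rw [OpenPartialHomeomorph.trans_source] at hp
  exact ((contMDiffAt_trivCoord hτ hθ he' hp.2).comp p
    (contMDiffAt_trivLift_const hτ hθ he hp.1 c)).contMDiffWithinAt

end CotangentTrivialization

/-! ### Orbits of the lifted action -/

section Orbits

variable {m : ℕ}
  {M : Type*} [TopologicalSpace M] [ChartedSpace (EuclideanSpace ℝ (Fin m)) M]
  [IsManifold (𝓡 m) ∞ M]
  {E : Type*} [TopologicalSpace E] [ChartedSpace (EuclideanSpace ℝ (Fin (m + 1))) E]
  [IsManifold (𝓡 (m + 1)) ∞ E] [MulAction Circle E]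
  {τ : E → M} {θ : CovectorField (𝓡 (m + 1)) E}

/-- The derivative at `q` of the action of `z`, as a linear map of the model space. -/
def dSmul (z : Circle) (q : E) :
    EuclideanSpace ℝ (Fin (m + 1)) →L[ℝ] EuclideanSpace ℝ (Fin (m + 1)) :=
  mfderiv (𝓡 (m + 1)) (𝓡 (m + 1)) (fun q' : E => z • q') q

theorem IsPrincipalCircleBundle.mdifferentiable_smul (hτ : IsPrincipalCircleBundle (m := m) τ)
    (z : Circle) : MDifferentiable (𝓡 (m + 1)) (𝓡 (m + 1)) (fun q : E => z • q) := by
  have := hτ.smooth_action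
  exact ((ContMDiffSMul.contMDiff_smul (I := 𝓡 1) (I' := 𝓡 (m + 1)) (n := ∞) (G := Circle)
    (M := E)).comp (contMDiff_const.prodMk contMDiff_id)).mdifferentiable (by simp)

theorem IsPrincipalCircleBundle.dSmul_comp_dSmul (hτ : IsPrincipalCircleBundle (m := m) τ)
    {z w : Circle} (h : w * z = 1) (q : E) :
    (dSmul (m := m) w (z • q)).comp (dSmul (m := m) z q) = ContinuousLinearMap.id ℝ _ := by
  have h1 := mfderiv_comp q (hτ.mdifferentiable_smul w (z • q)) (hτ.mdifferentiable_smul z q)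
  have h2 : ((fun q : E => w • q) ∘ fun q : E => z • q) = id := by
    funext q
    simp only [Function.comp_apply, smul_smul, h, one_smul, id]
  rw [h2, mfderiv_id] at h1
  exact h1.symm

theorem IsPrincipalCircleBundle.exists_equiv_dSmul (hτ : IsPrincipalCircleBundle (m := m) τ)
    (z : Circle) (q : E) :
    ∃ D : EuclideanSpace ℝ (Fin (m + 1)) ≃L[ℝ] EuclideanSpace ℝ (Fin (m + 1)),
      (D : EuclideanSpace ℝ (Fin (m + 1)) →L[ℝ] EuclideanSpace ℝ (Fin (m + 1))) = dSmul z q := by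
  have h1 := hτ.dSmul_comp_dSmul (inv_mul_cancel z) q
  have h2 := hτ.dSmul_comp_dSmul (mul_inv_cancel z) (z • q)
  rw [inv_smul_smul] at h2
  exact ⟨ContinuousLinearEquiv.equivOfInverse (dSmul z q) (dSmul z⁻¹ (z • q))
    (DFunLike.congr_fun h1) (DFunLike.congr_fun h2), rfl⟩

theorem IsPrincipalCircleBundle.dProj_dSmul (hτ : IsPrincipalCircleBundle (m := m) τ)
    (z : Circle) (q : E) (v : EuclideanSpace ℝ (Fin (m + 1))) :
    dProj τ (z • q) (dSmul z q v) = dProj τ q v := by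
  have h1 := mfderiv_comp q (hτ.smooth_proj.mdifferentiable (by simp) (z • q))
    (hτ.mdifferentiable_smul z q)
  have h2 : (τ ∘ fun q : E => z • q) = τ := funext fun q => hτ.proj_smul z q
  rw [h2] at h1
  exact (DFunLike.congr_fun h1 v).symm

theorem IsConnectionForm.covec_dSmul (hθ : IsConnectionForm θ) (z : Circle) (q : E)
    (v : EuclideanSpace ℝ (Fin (m + 1))) : covec θ (z • q) (dSmul z q v) = covec θ q v :=
  hθ.invariant z q v

/-- The fundamental field is invariant, being the vertical field on which `θ` takes the value
`1`. -/
theorem dSmul_fundVec (hτ : IsPrincipalCircleBundle (m := m) τ) (hθ : IsConnectionForm θ)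
    (z : Circle) (q : E) : dSmul z q (fundVec (m := m) q) = fundVec (m := m) (z • q) := by
  have h := hτ.eq_smul_fundVec hθ (z • q) (v := dSmul z q (fundVec q))
    ((hτ.dProj_dSmul z q _).trans (hτ.dProj_fundVec q))
  rwa [hθ.covec_dSmul, hθ.covec_fundVec, one_smul] at h

theorem fibre_liftedAction (hτ : IsPrincipalCircleBundle (m := m) τ) (z : Circle)
    (X : Cotangent (𝓡 (m + 1)) E) (v : EuclideanSpace ℝ (Fin (m + 1))) :
    fibre (liftedAction z X) (dSmul z X.proj v) = fibre X v := by
  obtain ⟨D, hD⟩ := hτ.exists_equiv_dSmul z X.proj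
  have h : fibre (liftedAction z X) (dSmul z X.proj v) =
    fibre X ((dSmul (m := m) z X.proj).inverse (dSmul z X.proj v)) := rfl
  rw [h, ← hD, ContinuousLinearMap.inverse_equiv]
  exact congrArg (fibre X) (D.symm_apply_apply v)

theorem momentum_liftedAction (hτ : IsPrincipalCircleBundle (m := m) τ) (hθ : IsConnectionForm θ)
    (z : Circle) (X : Cotangent (𝓡 (m + 1)) E) : momentum (liftedAction z X) = momentum X := by
  have h : momentum (liftedAction z X) = fibre (liftedAction z X) (fundVec (z • X.proj)) := rfl
  rw [h, ← dSmul_fundVec hτ hθ, fibre_liftedAction hτ]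
  rfl

theorem reduceCotangent_liftedAction (hτ : IsPrincipalCircleBundle (m := m) τ)
    (hθ : IsConnectionForm θ) (z : Circle) (X : Cotangent (𝓡 (m + 1)) E) :
    reduceCotangent τ θ (liftedAction z X) = reduceCotangent τ θ X := by
  refine (eq_reduceCotangent hτ hθ (liftedAction z X) (fibre (reduceCotangent τ θ X))
    fun v => ?_).symm.trans ?_
  · obtain ⟨D, hD⟩ := hτ.exists_equiv_dSmul z X.proj
    obtain ⟨u, rfl⟩ : ∃ u, dSmul z X.proj u = v := by
      rw [← hD]
      exact D.surjective v
    refine (congrArg (fibre (reduceCotangent τ θ X)) (hτ.dProj_dSmul z X.proj u)).trans ?_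
    refine (reduceCotangent_apply hτ hθ X u).trans ?_
    have h1 : horizontalPart θ (liftedAction z X) (dSmul z X.proj u) =
      fibre (liftedAction z X) (dSmul z X.proj u) -
        momentum (liftedAction z X) * covec θ (z • X.proj) (dSmul z X.proj u) := rfl
    rw [h1, fibre_liftedAction hτ, momentum_liftedAction hτ hθ, hθ.covec_dSmul]
    rfl
  · exact congrArg (fun b => (⟨b, fibre (reduceCotangent τ θ X)⟩ : Cotangent (𝓡 m) M))
      (hτ.proj_smul z X.proj)

theorem IsPrincipalCircleBundle.exists_smul_eq (hτ : IsPrincipalCircleBundle (m := m) τ) {q q' : E}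
    (h : τ q = τ q') : ∃ z : Circle, z • q = q' := by
  obtain ⟨e, he, he'⟩ := hτ.exists_trivialization_mem_source q
  have hq' : q' ∈ e.source := by
    rw [e.mem_source, ← h]
    exact e.mem_source.1 he
  have hz : ∀ z : Circle, z • q ∈ e.source := fun z => by
    rw [e.mem_source, hτ.proj_smul]
    exact e.mem_source.1 he
  refine ⟨(e q').2 / (e q).2, e.toOpenPartialHomeomorph.injOn (hz _) hq' ?_⟩
  change e _ = e q'
  refine Prod.ext ?_ ?_
  · rw [e.coe_fst (hz _), e.coe_fst hq', hτ.proj_smul, h]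
  · rw [he'.equivariant q he, div_mul_cancel]

/-- Two points of a level set have the same reduction if and only if they lie on one orbit. -/
theorem reduceCotangent_eq_iff (hτ : IsPrincipalCircleBundle (m := m) τ) (hθ : IsConnectionForm θ)
    {c : ℝ} (x y : Level m E c) :
    reduceCotangent τ θ x.1 = reduceCotangent τ θ y.1 ↔ ∃ z : Circle, liftedAction z x.1 = y.1 := by
  constructor
  · intro h
    obtain ⟨z, hz⟩ := hτ.exists_smul_eq (congrArg TotalSpace.proj h)
    refine ⟨z, ?_⟩
    rw [← liftCovector_reduceCotangent hτ hθ y.1,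
      ← liftCovector_reduceCotangent hτ hθ (liftedAction z x.1),
      reduceCotangent_liftedAction hτ hθ, momentum_liftedAction hτ hθ, h, x.2, y.2]
    exact congrArg (fun q => liftCovector τ θ q (fibre (reduceCotangent τ θ y.1)) c) hz
  · rintro ⟨z, hz⟩
    rw [← hz, reduceCotangent_liftedAction hτ hθ]

/-- The map induced by the reducing map on the symplectic quotient. -/
def quotientMap (hτ : IsPrincipalCircleBundle (m := m) τ) (hθ : IsConnectionForm θ) (c : ℝ) :
    SymplecticQuotient m E c → Cotangent (𝓡 m) M :=
  Quot.lift (fun x => reduceCotangent τ θ x.1) fun x y => (reduceCotangent_eq_iff hτ hθ x y).2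

theorem quotientMap_bijective (hτ : IsPrincipalCircleBundle (m := m) τ) (hθ : IsConnectionForm θ)
    (c : ℝ) : Function.Bijective (quotientMap hτ hθ c) := by
  constructor
  · rintro ⟨x⟩ ⟨y⟩ h
    exact Quot.sound ((reduceCotangent_eq_iff hτ hθ x y).1 h)
  · intro Y
    obtain ⟨e, he, -⟩ := hτ.exists_trivialization Y.proj
    exact ⟨quotientProj c ⟨trivLift e θ (Y, 1) c, momentum_trivLift hτ hθ _ c⟩,
      congrArg Prod.fst (trivCoord_trivLift hτ hθ (p := (Y, 1)) he c)⟩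

/-- The local section `Y ↦ [lift of Y]` of the quotient given by a trivialization is the inverse of
the induced map. -/
theorem quotientProj_trivLift (hτ : IsPrincipalCircleBundle (m := m) τ) (hθ : IsConnectionForm θ)
    (c : ℝ) {e : Trivialization Circle τ} {Y : Cotangent (𝓡 m) M} (hY : Y.proj ∈ e.baseSet) :
    quotientProj c ⟨trivLift e θ (Y, 1) c, momentum_trivLift hτ hθ _ c⟩ =
      (Equiv.ofBijective _ (quotientMap_bijective hτ hθ c)).symm Y := by
  rw [Equiv.eq_symm_apply]
  exact congrArg Prod.fst (trivCoord_trivLift hτ hθ (p := (Y, 1)) hY c)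

theorem continuousAt_trivLift_one (hτ : IsPrincipalCircleBundle (m := m) τ)
    (hθ : IsConnectionForm θ) (c : ℝ) {e : Trivialization Circle τ}
    (he : IsSmoothTrivialization (m := m) e) {Y : Cotangent (𝓡 m) M} (hY : Y.proj ∈ e.baseSet) :
    ContinuousAt (fun Y : Cotangent (𝓡 m) M =>
      (⟨trivLift e θ (Y, 1) c, momentum_trivLift hτ hθ _ c⟩ : Level m E c)) Y :=
  ContinuousAt.comp (f := fun Y : Cotangent (𝓡 m) M => (Y, (1 : Circle)))
    ((levelTriv hτ hθ he c).symm.continuousAt (x := (Y, 1)) hY)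
    (continuousAt_id.prodMk continuousAt_const)

/-- The map induced by the reducing map, as a homeomorphism onto `T^*M`. -/
def quotientHomeomorph (hτ : IsPrincipalCircleBundle (m := m) τ) (hθ : IsConnectionForm θ) (c : ℝ) :
    SymplecticQuotient m E c ≃ₜ Cotangent (𝓡 m) M where
  toEquiv := Equiv.ofBijective _ (quotientMap_bijective hτ hθ c)
  continuous_toFun := continuous_quot_lift _
    ((contMDiff_reduceCotangent hτ hθ).continuous.comp continuous_subtype_val)
  continuous_invFun := by
    rw [continuous_iff_continuousAt]
    intro Y
    obtain ⟨e, hY, he⟩ := hτ.exists_trivialization Y.proj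
    have h : ContinuousAt (quotientProj (m := m) (E := E) c ∘ fun Y : Cotangent (𝓡 m) M =>
        (⟨trivLift e θ (Y, 1) c, momentum_trivLift hτ hθ _ c⟩ : Level m E c)) Y :=
      continuous_quot_mk.continuousAt.comp (continuousAt_trivLift_one hτ hθ c he hY)
    refine h.congr ?_
    filter_upwards [contMDiff_proj.continuous.continuousAt.preimage_mem_nhds
      (e.open_baseSet.mem_nhds hY)] with Y' hY'
    exact quotientProj_trivLift hτ hθ c hY'

end Orbits

/-! ### Existence of the reduction structure -/

section Existence

variable {m : ℕ}
  {M : Type*} [TopologicalSpace M] [ChartedSpace (EuclideanSpace ℝ (Fin m)) M]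
  [IsManifold (𝓡 m) ∞ M]
  {E : Type*} [TopologicalSpace E] [ChartedSpace (EuclideanSpace ℝ (Fin (m + 1))) E]
  [IsManifold (𝓡 (m + 1)) ∞ E] [MulAction Circle E]
  {τ : E → M} {θ : CovectorField (𝓡 (m + 1)) E}

theorem finrank_continuousDual (V : Type*) [NormedAddCommGroup V] [NormedSpace ℝ V]
    [FiniteDimensional ℝ V] : Module.finrank ℝ (V →L[ℝ] ℝ) = Module.finrank ℝ V :=
  (LinearMap.toContinuousLinearMap (𝕜 := ℝ) (E := V) (F' := ℝ)).finrank_eq.symm.trans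
    (Subspace.dual_finrank_eq (K := ℝ) (V := V))

/-- The model spaces of `T^*M` and of the quotient. -/
def quotientModelEquiv (m : ℕ) :
    (EuclideanSpace ℝ (Fin m) × (EuclideanSpace ℝ (Fin m) →L[ℝ] ℝ)) ≃L[ℝ]
      EuclideanSpace ℝ (Fin (2 * m)) :=
  ContinuousLinearEquiv.ofFinrankEq (by
    rw [Module.finrank_prod, finrank_continuousDual, finrank_euclideanSpace_fin,
      finrank_euclideanSpace_fin]
    omega)

/-- The model spaces of `T^*M × S¹` and of the level set. -/
def levelModelEquiv (m : ℕ) :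
    ((EuclideanSpace ℝ (Fin m) × (EuclideanSpace ℝ (Fin m) →L[ℝ] ℝ)) ×
      EuclideanSpace ℝ (Fin 1)) ≃L[ℝ] EuclideanSpace ℝ (Fin (2 * m + 1)) :=
  ContinuousLinearEquiv.ofFinrankEq (by
    rw [Module.finrank_prod, Module.finrank_prod, finrank_continuousDual,
      finrank_euclideanSpace_fin, finrank_euclideanSpace_fin, finrank_euclideanSpace_fin]
    omega)

/-- The model spaces of `T^*M × S¹ × ℝ` and of `T^*E`. -/
def totalModelEquiv (m : ℕ) :
    (((EuclideanSpace ℝ (Fin m) × (EuclideanSpace ℝ (Fin m) →L[ℝ] ℝ)) ×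
      EuclideanSpace ℝ (Fin 1)) × ℝ) ≃L[ℝ]
    EuclideanSpace ℝ (Fin (m + 1)) × (EuclideanSpace ℝ (Fin (m + 1)) →L[ℝ] ℝ) :=
  ContinuousLinearEquiv.ofFinrankEq (by
    simp only [Module.finrank_prod, finrank_continuousDual, finrank_euclideanSpace_fin,
      Module.finrank_self]
    omega)

/-- The local trivializations of `T^*E` and of the level sets provide the charts. -/
theorem exists_isReductionStructure (hτ : IsPrincipalCircleBundle (m := m) τ)
    (hθ : IsConnectionForm θ) (c : ℝ) :
    ∃ (_ : ChartedSpace (EuclideanSpace ℝ (Fin (2 * m + 1))) (Level m E c))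
      (_ : ChartedSpace (EuclideanSpace ℝ (Fin (2 * m))) (SymplecticQuotient m E c)),
      IsReductionStructure (m := m) (E := E) c := by
  choose e he he' using fun q : E => hτ.exists_trivialization_mem_source q
  let L : Level m E c → OpenPartialHomeomorph (Level m E c) (Cotangent (𝓡 m) M × Circle) :=
    fun x => levelTriv hτ hθ (he' x.1.proj) c
  have hL : ∀ x, x ∈ (L x).source := fun x => he x.1.proj
  have hLL : ∀ x x', ContMDiffOn (cotangentCircleModel m) (cotangentCircleModel m) ∞
      ((L x).symm.trans (L x')) ((L x).symm.trans (L x')).source := fun x x' =>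
    contMDiffOn_levelTriv_trans hτ hθ (he' x.1.proj) (he' x'.1.proj) c
  let L' : SymplecticQuotient m E c →
      OpenPartialHomeomorph (SymplecticQuotient m E c) (Cotangent (𝓡 m) M) :=
    fun _ => (quotientHomeomorph hτ hθ c).toOpenPartialHomeomorph
  have hL' : ∀ x, x ∈ (L' x).source := fun x => trivial
  have hLL' : ∀ x x', ContMDiffOn (cotangentModel (𝓡 m)) (cotangentModel (𝓡 m)) ∞
      ((L' x).symm.trans (L' x')) ((L' x).symm.trans (L' x')).source := fun x x' =>
    contMDiffOn_id.congr fun Y _ => (quotientHomeomorph hτ hθ c).apply_symm_apply Y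
  let levelCharts : ChartedSpace (EuclideanSpace ℝ (Fin (2 * m + 1))) (Level m E c) :=
    chartedSpaceOfLocalModels (cotangentCircleModel m) (levelModelEquiv m) L hL
  let quotientCharts : ChartedSpace (EuclideanSpace ℝ (Fin (2 * m))) (SymplecticQuotient m E c) :=
    chartedSpaceOfLocalModels (cotangentModel (𝓡 m)) (quotientModelEquiv m) L' hL'
  refine ⟨levelCharts, quotientCharts, ⟨?_, ⟨?_, ?_⟩, ?_, ?_⟩⟩
  · exact isManifold_of_localModels _ _ L hL hLL
  · refine Manifold.IsImmersionOfComplement.isImmersion (F := ℝ)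
      (isImmersionOfComplement_of_localModels (cotangentCircleModel m) 𝓘(ℝ, ℝ) hL hLL
        (totalModelEquiv m) continuous_subtype_val
        (fun x => cotangentTriv hτ hθ (he' x.1.proj) c) 0
        (fun x => contMDiffOn_cotangentTriv hτ hθ (he' x.1.proj) c)
        (fun x => contMDiffOn_cotangentTriv_symm hτ hθ (he' x.1.proj) c)
        (fun x => he x.1.proj) ?_ ?_)
    · intro x x' _
      refine Prod.ext rfl ?_
      change momentum x'.1 - c = 0
      rw [x'.2, sub_self]
    · rfl
  · exact IsEmbedding.subtypeVal
  · exact isManifold_of_localModels _ _ L' hL' hLL'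
  · exact Manifold.IsSubmersionOfComplement.isSubmersion (F := EuclideanSpace ℝ (Fin 1))
      (isSubmersionOfComplement_of_localModels (cotangentModel (𝓡 m)) (𝓡 1) hL hLL hL' hLL'
        continuous_quot_mk fun x x' _ => rfl)

end Existence

/-! ### Submersions -/

section Submersions

variable {V : Type*} [NormedAddCommGroup V] [NormedSpace ℝ V] {H : Type*} [TopologicalSpace H]
  {I : ModelWithCorners ℝ V H} {N : Type*} [TopologicalSpace N] [ChartedSpace H N]
  {V' : Type*} [NormedAddCommGroup V'] [NormedSpace ℝ V'] {H' : Type*} [TopologicalSpace H']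
  {I' : ModelWithCorners ℝ V' H'} {N' : Type*} [TopologicalSpace N'] [ChartedSpace H' N']

/-- A submersion has a smooth local section through each point. -/
theorem exists_localSection [I.Boundaryless] {f : N → N'} (hf : Manifold.IsSubmersion I I' ∞ f)
    (x : N) : ∃ s : N' → N, s (f x) = x ∧ ContMDiffAt I' I ∞ s (f x) ∧
      ∀ᶠ y in 𝓝 (f x), f (s y) = y := by
  have h := hf.isSubmersionOfComplement_complement x
  have hw := h.writtenInCharts
  have hx := h.mem_domChart_source
  have hfx := h.mem_codChart_source
  let φ := h.domChart.extend I
  let ψ := h.codChart.extend I'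
  have hφx : x ∈ φ.source := by rwa [OpenPartialHomeomorph.extend_source]
  have hφ : φ x ∈ φ.target := φ.map_source hφx
  have h1 : ψ (f x) = (h.equiv (φ x)).1 := by
    have h2 := hw hφ
    simp only [Function.comp_apply] at h2
    rwa [φ.left_inv hφx] at h2
  let r : N' → V := fun y => h.equiv.symm (ψ y, (h.equiv (φ x)).2)
  have hr0 : r (f x) = φ x := by
    simp only [r]
    rw [h1]
    exact h.equiv.symm_apply_apply _
  have hr : ContMDiffAt I' 𝓘(ℝ, V) ∞ r (f x) := by
    refine h.equiv.symm.contDiff.contMDiff.contMDiffAt.comp (f x) ?_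
    have h2 : ContMDiffAt I' 𝓘(ℝ, V') ∞ ψ (f x) :=
      (ModelWithCorners.contMDiff (I := I')).contMDiffAt.comp (f x)
        (contMDiffAt_of_mem_maximalAtlas h.codChart_mem_maximalAtlas hfx)
    exact h2.prodMk_space contMDiffAt_const
  have hφo : φ.target ∈ 𝓝 (r (f x)) := by
    rw [hr0]
    exact h.domChart.isOpen_extend_target.mem_nhds hφ
  have hφs : ContMDiffOn 𝓘(ℝ, V) I ∞ φ.symm φ.target := by
    have h2 := contMDiffOn_extend_symm (I := I) h.domChart_mem_maximalAtlas
    rwa [I.image_eq, ← OpenPartialHomeomorph.extend_target] at h2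
  refine ⟨φ.symm ∘ r, ?_, (hφs.contMDiffAt hφo).comp (f x) hr, ?_⟩
  · rw [Function.comp_apply, hr0, φ.left_inv hφx]
  · filter_upwards [hr.continuousAt.preimage_mem_nhds hφo,
      h.codChart.open_source.mem_nhds hfx] with y hy hy'
    have h2 : φ.symm (r y) ∈ h.domChart.source := by
      have h3 := φ.map_target hy
      rwa [OpenPartialHomeomorph.extend_source] at h3
    refine ψ.injOn ?_ ?_ ?_
    · rw [OpenPartialHomeomorph.extend_source]
      exact h.source_subset_preimage_source h2
    · rwa [OpenPartialHomeomorph.extend_source]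
    · refine (hw hy).trans ?_
      exact congrArg Prod.fst (h.equiv.apply_symm_apply (ψ y, (h.equiv (φ x)).2))

theorem mfderiv_surjective_of_isSubmersion [I.Boundaryless] {f : N → N'}
    (hf : Manifold.IsSubmersion I I' ∞ f) (x : N) :
    Function.Surjective (mfderiv I I' f x) := by
  obtain ⟨s, hs, hs', hfs⟩ := exists_localSection hf x
  have h1 := mfderiv_comp (f x)
    (hs.symm ▸ (hf.contMDiff.mdifferentiable (by simp)) x : MDifferentiableAt I I' f (s (f x)))
    (hs'.mdifferentiableAt (by simp))
  rw [Filter.EventuallyEq.mfderiv_eq (f₁ := f ∘ s) (f := id) hfs, mfderiv_id] at h1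
  intro v
  have h2 := DFunLike.congr_fun h1 v
  rw [hs] at h2
  exact ⟨_, h2.symm⟩

/-- A form on the base of a surjective submersion is determined by its pullback. -/
theorem pullback_injective [I.Boundaryless] {f : N → N'} (hf : Manifold.IsSubmersion I I' ∞ f)
    (hf' : Function.Surjective f) {k : ℕ} {η₁ η₂ : DForm I' N' k}
    (h : (pullback I' f η₁ : DForm I N k) = pullback I' f η₂) : η₁ = η₂ := by
  funext y
  obtain ⟨x, rfl⟩ := hf' y
  ext v
  choose w hw using fun i => mfderiv_surjective_of_isSubmersion hf x (v i)
  obtain rfl : (fun i => mfderiv I I' f x (w i)) = v := funext hw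
  exact DFunLike.congr_fun (congrFun h x) w

/-- Maps out of the base of a surjective submersion are smooth if their composition with the
submersion is. -/
theorem contMDiff_of_comp_submersion [I.Boundaryless] {f : N → N'}
    (hf : Manifold.IsSubmersion I I' ∞ f) (hf' : Function.Surjective f)
    {V'' : Type*} [NormedAddCommGroup V''] [NormedSpace ℝ V''] {H'' : Type*} [TopologicalSpace H'']
    {I'' : ModelWithCorners ℝ V'' H''} {N'' : Type*} [TopologicalSpace N''] [ChartedSpace H'' N'']
    {g : N' → N''} (hg : ContMDiff I I'' ∞ (g ∘ f)) : ContMDiff I' I'' ∞ g := by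
  intro y
  obtain ⟨x, rfl⟩ := hf' y
  obtain ⟨s, hs, hs', hfs⟩ := exists_localSection hf x
  refine (hg.contMDiffAt.comp (f x) hs').congr_of_eventuallyEq ?_
  filter_upwards [hfs] with y hy
  exact (congrArg g hy).symm

end Submersions

/-! ### The reducing map and the reduced form -/

section ReducedForm

variable {m : ℕ}
  {M : Type*} [TopologicalSpace M] [ChartedSpace (EuclideanSpace ℝ (Fin m)) M]
  [IsManifold (𝓡 m) ∞ M]
  {E : Type*} [TopologicalSpace E] [ChartedSpace (EuclideanSpace ℝ (Fin (m + 1))) E]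
  [IsManifold (𝓡 (m + 1)) ∞ E] [MulAction Circle E]
  {τ : E → M} {θ : CovectorField (𝓡 (m + 1)) E}

/-- The reducing map `Π_c`. -/
def reducingMap (τ : E → M) (θ : CovectorField (𝓡 (m + 1)) E) (c : ℝ) (x : Level m E c) :
    Cotangent (𝓡 m) M :=
  reduceCotangent τ θ x.1

theorem isReducingMap_reducingMap (hτ : IsPrincipalCircleBundle (m := m) τ)
    (hθ : IsConnectionForm θ) (c : ℝ) : IsReducingMap τ θ c (reducingMap τ θ c) := fun x => by
  refine ⟨fibre (reduceCotangent τ θ x.1), rfl, fun v => ?_⟩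
  have h := reduceCotangent_apply hτ hθ x.1 v
  have h2 : horizontalPart θ x.1 v = x.1.2 v - momentum x.1 * θ x.1.proj v := rfl
  rw [x.2] at h2
  exact h.trans h2

theorem eq_reducingMap (hτ : IsPrincipalCircleBundle (m := m) τ)
    (hθ : IsConnectionForm θ) {c : ℝ} {Pc : Level m E c → Cotangent (𝓡 m) M}
    (hPc : IsReducingMap τ θ c Pc) : Pc = reducingMap τ θ c := by
  funext x
  obtain ⟨p, hp, hp'⟩ := hPc x
  rw [hp]
  refine eq_reduceCotangent hτ hθ x.1 p fun v => ?_
  have h2 : horizontalPart θ x.1 v = x.1.2 v - momentum x.1 * θ x.1.proj v := rfl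
  rw [h2, x.2]
  exact hp' v

section Level

variable {c : ℝ} [ChartedSpace (EuclideanSpace ℝ (Fin (2 * m + 1))) (Level m E c)]
  [IsManifold (𝓡 (2 * m + 1)) ∞ (Level m E c)]

/-- The base point projection of the level set. -/
def levelProj (c : ℝ) (x : Level m E c) : E := x.1.proj

/-- On the level set, the Liouville form of `T^*M` pulls back to that of `T^*E` minus `c θ`. -/
theorem pullback_liouville (hτ : IsPrincipalCircleBundle (m := m) τ) (hθ : IsConnectionForm θ)
    (hι : ContMDiff (𝓡 (2 * m + 1)) (cotangentModel (𝓡 (m + 1))) ∞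
      (levelIncl (m := m) (E := E) c)) :
    (pullback (cotangentModel (𝓡 m)) (reducingMap τ θ c) (oneForm liouville) :
      DForm (𝓡 (2 * m + 1)) (Level m E c) 1) =
    pullback (cotangentModel (𝓡 (m + 1))) (levelIncl c) (oneForm liouville) +
      (-c) • pullback (𝓡 (m + 1)) (levelProj c) (oneForm θ) := by
  have hP : ContMDiff (𝓡 (2 * m + 1)) (cotangentModel (𝓡 m)) ∞
    (reducingMap (m := m) τ θ c) := (contMDiff_reduceCotangent hτ hθ).comp hι
  have hj : ContMDiff (𝓡 (2 * m + 1)) (𝓡 (m + 1)) ∞ (levelProj (m := m) (E := E) c) :=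
    contMDiff_proj.comp hι
  funext x
  ext u
  -- the image in `E` of the tangent vector
  let w : EuclideanSpace ℝ (Fin (m + 1)) :=
    mfderiv (𝓡 (2 * m + 1)) (𝓡 (m + 1)) (levelProj (m := m) (E := E) c) x (u 0)
  -- the base point of the reduction is the projection to `M` of the base point in `E`
  have h1 : mfderiv (cotangentModel (𝓡 m)) (𝓡 m) (fun Y : Cotangent (𝓡 m) M => Y.proj)
      (reducingMap τ θ c x) (mfderiv (𝓡 (2 * m + 1)) (cotangentModel (𝓡 m))
        (reducingMap τ θ c) x (u 0)) = dProj (m := m) τ x.1.proj w := by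
    have h2 := mfderiv_comp x ((contMDiff_proj (I := 𝓡 m) (N := M)).mdifferentiable (by simp)
      (reducingMap τ θ c x)) (hP.mdifferentiable (by simp) x)
    have h3 := mfderiv_comp x (hτ.smooth_proj.mdifferentiable (by simp) (levelProj c x))
      (hj.mdifferentiable (by simp) x)
    exact DFunLike.congr_fun (h2.symm.trans h3) (u 0)
  have h4 : mfderiv (cotangentModel (𝓡 (m + 1))) (𝓡 (m + 1))
      (fun Y : Cotangent (𝓡 (m + 1)) E => Y.proj) (levelIncl c x)
      (mfderiv (𝓡 (2 * m + 1)) (cotangentModel (𝓡 (m + 1))) (levelIncl c) x (u 0)) = w :=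
    (DFunLike.congr_fun (mfderiv_comp x ((contMDiff_proj (I := 𝓡 (m + 1)) (N := E)).mdifferentiable
      (by simp) (levelIncl c x)) (hι.mdifferentiable (by simp) x)) (u 0)).symm
  have h5 : horizontalPart θ x.1 w = fibre x.1 w - momentum x.1 * covec θ x.1.proj w := rfl
  rw [x.2, sub_eq_add_neg, ← neg_mul] at h5
  refine (congrArg (fibre (reduceCotangent τ θ x.1)) h1).trans ?_
  refine (reduceCotangent_apply hτ hθ x.1 w).trans (h5.trans ?_)
  exact congrArg (· + -c * covec θ x.1.proj w) (congrArg (fibre x.1) h4.symm)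

/-- The twisted form of `T^*M` and the standard form of `T^*E` have the same pullback to the level
set. -/
theorem pullback_twistedForm (hτ : IsPrincipalCircleBundle (m := m) τ) (hθ : IsConnectionForm θ)
    {σ : DForm (𝓡 m) M 2} (hθσ : extD (oneForm θ) = pullback (𝓡 m) τ σ)
    (hι : ContMDiff (𝓡 (2 * m + 1)) (cotangentModel (𝓡 (m + 1))) ∞
      (levelIncl (m := m) (E := E) c)) :
    (pullback (cotangentModel (𝓡 m)) (reducingMap τ θ c) (twistedForm c σ) :
      DForm (𝓡 (2 * m + 1)) (Level m E c) 2) =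
    pullback (cotangentModel (𝓡 (m + 1))) (levelIncl c) (canonicalForm (𝓡 (m + 1)) E) := by
  have hP : ContMDiff (𝓡 (2 * m + 1)) (cotangentModel (𝓡 m)) ∞
    (reducingMap (m := m) τ θ c) := (contMDiff_reduceCotangent hτ hθ).comp hι
  have hj : ContMDiff (𝓡 (2 * m + 1)) (𝓡 (m + 1)) ∞ (levelProj (m := m) (E := E) c) :=
    contMDiff_proj.comp hι
  have h1 := congrArg extD (pullback_liouville hτ hθ hι)
  rw [extD_pullback isSmoothForm_liouville hP,
    extD_add (isSmoothForm_liouville.pullback hι) ((hθ.smooth.pullback hj).smul (-c)),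
    extD_pullback isSmoothForm_liouville hι, extD_smul, extD_pullback hθ.smooth hj, hθσ,
    ← pullback_comp (hj.mdifferentiable (by simp)) (hτ.smooth_proj.mdifferentiable (by simp))]
    at h1
  have h2 := pullback_comp (hP.mdifferentiable (by simp))
    ((contMDiff_proj (I := 𝓡 m) (N := M)).mdifferentiable (by simp)) σ
  have h3 : (τ ∘ levelProj c : Level m E c → M) =
    (fun Y : Cotangent (𝓡 m) M => Y.proj) ∘ reducingMap τ θ c := rfl
  rw [h3, h2] at h1
  rw [twistedForm, pullback_add, pullback_smul]
  refine (congrArg (· + c • pullback (cotangentModel (𝓡 m)) (reducingMap τ θ c)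
    (pullback (𝓡 m) (fun Y : Cotangent (𝓡 m) M => Y.proj) σ)) h1).trans ?_
  funext x
  ext v
  exact (by intros; ring : ∀ a b : ℝ, a + -c * b + c * b = a) _ _

end Level

end ReducedForm

/-! ### Reduction for an arbitrary reduction structure -/

section Reduction

variable {m : ℕ}
  {M : Type*} [TopologicalSpace M] [ChartedSpace (EuclideanSpace ℝ (Fin m)) M]
  [IsManifold (𝓡 m) ∞ M]
  {E : Type*} [TopologicalSpace E] [ChartedSpace (EuclideanSpace ℝ (Fin (m + 1))) E]
  [IsManifold (𝓡 (m + 1)) ∞ E] [MulAction Circle E]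
  {τ : E → M} {θ : CovectorField (𝓡 (m + 1)) E} {c : ℝ}
  [ChartedSpace (EuclideanSpace ℝ (Fin (2 * m + 1))) (Level m E c)]
  [ChartedSpace (EuclideanSpace ℝ (Fin (2 * m))) (SymplecticQuotient m E c)]

theorem surjective_quotientProj : Function.Surjective (quotientProj (m := m) (E := E) c) :=
  Quot.mk_surjective

theorem contMDiff_quotientMap (hτ : IsPrincipalCircleBundle (m := m) τ) (hθ : IsConnectionForm θ)
    (h : IsReductionStructure (m := m) (E := E) c) :
    ContMDiff (𝓡 (2 * m)) (cotangentModel (𝓡 m)) ∞ (quotientMap hτ hθ c) := by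
  have := h.level_manifold
  exact contMDiff_of_comp_submersion h.proj_submersion surjective_quotientProj
    ((contMDiff_reduceCotangent hτ hθ).comp h.level_embedded.contMDiff)

theorem contMDiff_quotientMap_symm (hτ : IsPrincipalCircleBundle (m := m) τ)
    (hθ : IsConnectionForm θ) (h : IsReductionStructure (m := m) (E := E) c) :
    ContMDiff (cotangentModel (𝓡 m)) (𝓡 (2 * m)) ∞
      (Equiv.ofBijective _ (quotientMap_bijective (m := m) hτ hθ c)).symm := by
  intro Y
  obtain ⟨e, hY, he⟩ := hτ.exists_trivialization Y.proj
  have h1 : ContMDiffAt (cotangentModel (𝓡 m)) (𝓡 (2 * m + 1)) ∞ (fun Y : Cotangent (𝓡 m) M =>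
      (⟨trivLift e θ (Y, 1) c, momentum_trivLift hτ hθ _ c⟩ : Level m E c)) Y := by
    refine (ContMDiffAt.iff_comp_isImmersionAt
      (h.level_embedded.isImmersion.isImmersionAt _)).2
      ⟨continuousAt_trivLift_one hτ hθ c he hY, ?_⟩
    exact ContMDiffAt.comp Y (f := fun Y : Cotangent (𝓡 m) M => (Y, (1 : Circle)))
      (contMDiffAt_trivLift_const hτ hθ he (p := (Y, 1)) hY c)
      (contMDiffAt_id.prodMk contMDiffAt_const)
  refine (h.proj_submersion.contMDiff.contMDiffAt.comp Y h1).congr_of_eventuallyEq ?_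
  filter_upwards [contMDiff_proj.continuous.continuousAt.preimage_mem_nhds
    (e.open_baseSet.mem_nhds hY)] with Y' hY'
  exact (quotientProj_trivLift hτ hθ c hY').symm

/-- The diffeomorphism from the symplectic quotient to `T^*M` induced by the reducing map. -/
def quotientDiffeomorph (hτ : IsPrincipalCircleBundle (m := m) τ) (hθ : IsConnectionForm θ)
    (h : IsReductionStructure (m := m) (E := E) c) :
    Diffeomorph (𝓡 (2 * m)) (cotangentModel (𝓡 m)) (SymplecticQuotient m E c)
      (Cotangent (𝓡 m) M) ∞ where
  toEquiv := Equiv.ofBijective _ (quotientMap_bijective hτ hθ c)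
  contMDiff_toFun := contMDiff_quotientMap hτ hθ h
  contMDiff_invFun := contMDiff_quotientMap_symm hτ hθ h

theorem isReducedForm_pullback (hτ : IsPrincipalCircleBundle (m := m) τ) (hθ : IsConnectionForm θ)
    {σ : DForm (𝓡 m) M 2} (hθσ : extD (oneForm θ) = pullback (𝓡 m) τ σ)
    (h : IsReductionStructure (m := m) (E := E) c) :
    IsReducedForm c (pullback (cotangentModel (𝓡 m)) (quotientDiffeomorph hτ hθ h)
      (twistedForm c σ)) := by
  have := h.level_manifold
  have h1 := pullback_comp (h.proj_submersion.contMDiff.mdifferentiable (by simp))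
    ((contMDiff_quotientMap hτ hθ h).mdifferentiable (by simp)) (twistedForm c σ)
  exact h1.symm.trans (pullback_twistedForm hτ hθ hθσ h.level_embedded.contMDiff)

end Reduction

end MagneticReduction

end

theorem mainTheorem4 {m : ℕ}
    {M : Type*} [TopologicalSpace M] [T2Space M] [SecondCountableTopology M]
    [ChartedSpace (EuclideanSpace ℝ (Fin m)) M] [IsManifold (𝓡 m) ∞ M]
    {E : Type*} [TopologicalSpace E] [ChartedSpace (EuclideanSpace ℝ (Fin (m + 1))) E]
    [IsManifold (𝓡 (m + 1)) ∞ E] [MulAction Circle E]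
    (τ : E → M) (hτ : IsPrincipalCircleBundle (m := m) τ)
    (σ : DForm (𝓡 m) M 2)
    (hσ : IsSmoothForm σ) (hσ' : extD σ = 0)
    (θ : CovectorField (𝓡 (m + 1)) E)
    (hθ : IsConnectionForm θ)
    (hθσ : extD (oneForm θ) =
      pullback (𝓡 m) τ σ)
    (c : ℝ) :
    -- the twisted cotangent bundle is a symplectic manifold
    IsSymplecticForm (twistedForm c σ) ∧
    -- the map `Π_c` is well defined by its implicit equation
    ∃ Pc : Level m E c → Cotangent (𝓡 m) M,
      IsReducingMap τ θ c Pc ∧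
      (∀ Pc', IsReducingMap τ θ c Pc' → Pc' = Pc) ∧
      -- the symplectic quotient is a manifold
      (∃ (_ : ChartedSpace (EuclideanSpace ℝ (Fin (2 * m + 1))) (Level m E c))
        (_ : ChartedSpace (EuclideanSpace ℝ (Fin (2 * m)))
          (SymplecticQuotient m E c)),
        IsReductionStructure (m := m) (E := E) c) ∧
      ∀ [ChartedSpace (EuclideanSpace ℝ (Fin (2 * m + 1))) (Level m E c)]
        [ChartedSpace (EuclideanSpace ℝ (Fin (2 * m)))
          (SymplecticQuotient m E c)],
        IsReductionStructure (m := m) (E := E) c →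
        -- it carries a unique reduced form, which is symplectic
        ∃ ωc : DForm (𝓡 (2 * m)) (SymplecticQuotient m E c) 2,
          IsReducedForm c ωc ∧
          (∀ ωc', IsReducedForm c ωc' → ωc' = ωc) ∧
          IsSymplecticForm ωc ∧
          -- and `Π_c` induces a symplectomorphism onto the twisted cotangent bundle
          ∃ Φ : Diffeomorph (𝓡 (2 * m)) (cotangentModel (𝓡 m))
              (SymplecticQuotient m E c)
              (Cotangent (𝓡 m) M) ∞,
            (∀ x, Φ (quotientProj c x) = Pc x) ∧
            pullback (cotangentModel (𝓡 m)) Φ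
              (twistedForm c σ) = ωc := by

  refine ⟨isSymplecticForm_twistedForm c hσ hσ', reducingMap τ θ c,
    isReducingMap_reducingMap hτ hθ c, fun Pc' h => eq_reducingMap hτ hθ h,
    exists_isReductionStructure hτ hθ c, ?_⟩
  intro _ _ h
  have := h.level_manifold
  have := h.quotient_manifold
  refine ⟨pullback (cotangentModel (𝓡 m)) (quotientDiffeomorph hτ hθ h) (twistedForm c σ),
    isReducedForm_pullback hτ hθ hθσ h, fun ωc' h' => ?_,
    (isSymplecticForm_twistedForm c hσ hσ').pullback (quotientDiffeomorph hτ hθ h),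
    quotientDiffeomorph hτ hθ h, fun x => rfl, rfl⟩
  exact pullback_injective h.proj_submersion surjective_quotientProj
    (h'.trans (isReducedForm_pullback hτ hθ hθσ h).symm)
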